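/- Let $\theta\in\mathbb{R}$ and let $\mathcal{A}_\theta$ be the smooth noncommutative torus: inside the universal $C^*$-algebra generated by unitaries $U,V$ with $UV=e^{-2\pi i\theta}VU$, it is the subalgebra of all $\sum_{r\in\mathbb{Z}^2}a_rU^{r_1}V^{r_2}$ whose coefficients $(a_r)$ decay faster than the inverse of any polynomial in $r$. Let $\delta_j\bigl(\sum_r a_rU^{r_1}V^{r_2}\bigr)=\sum_r r_ja_rU^{r_1}V^{r_2}$ for $j=1,2$, $d=\delta_1-i\delta_2$, $d^*=\delta_1+i\delta_2$. On the vector space $\mathcal{A}_\theta\otimes\mathbb{C}^2$ let $D=\begin{pmatrix}0&d\\ d^*&0\end{pmatrix}$ and $\gamma=\begin{pmatrix}1&0\\0&-1\end{pmatrix}$, and let $\pi(a)$, $a\in\mathcal{A}_\theta$, be diagonal left multiplication by $a$. Let $\widetilde{\mathcal{A}_\theta}=\mathcal{A}_\theta\oplus\mathcal{A}_\theta$ with product $(a,b)\star(a',b')=(aa'+bb',ab'+ba')$, represented on $\mathcal{A}_\theta\otimes\mathbb{C}^2$ by $(a,b)\mapsto\pi(a)+\gamma\pi(b)$. For a unital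 algebra $A$ represented by $\pi$ on the space on which an operator $D$ acts, let $\Omega^k(A)=A\otimes(A/\mathbb{C})^{\otimes k}$ with $d(a_0\otimes\overline{a_1}\otimes\cdots\otimes\overline{a_k})=1\otimes\overline{a_0}\otimes\cdots\otimes\overline{a_k}$, let $\pi(a_0\otimes\overline{a_1}\otimes\cdots\otimes\overline{a_k})=\pi(a_0)[D,\pi(a_1)]\cdots[D,\pi(a_k)]$, $J_0^k=\ker(\pi|_{\Omega^k(A)})$, $J^0=J_0^0$, $J^k=J_0^k+dJ_0^{k-1}$ for $k\ge1$, and $\Omega_D^k(A)=\Omega^k(A)/J^k$ with the induced differential $\widetilde d$. Write $M_a$ for left multiplication by $a$ on $\mathcal{A}_\theta$. Theorem. There are $\mathbb{C}$-linear isomorphisms $$\Phi_0:\Omega_D^0(\widetilde{\mathcal{A}_\theta})\to\mathcal{A}_\theta^2,\qquad \Phi_1:\Omega_D^1(\widetilde{\mathcal{A}_\theta})\to\mathcal{A}_\theta^4,\qquad \Phi_2:\Omega_D^2(\widetilde{\mathcal{A}_\theta})\to\mathcal{A}_\theta^2$$ such that * if $\Phi_0[\omega]=(a,b)$, then $\pi(\omega)=\begin{pmatrix}M_a&0\\0&M_b\end{pmatrix}$;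 * if $\Phi_1[\omega]=(a,b,c,e)$, then $\pi(\omega)=\begin{pmatrix}0&M_a+M_b d\\ M_c+M_e d^*&0\end{pmatrix}$; * if $\Phi_2[\omega]=(w,w')$, then, for some $p,q,r,p',q',r'\in\mathcal{A}_\theta$, $\pi(\omega)$ is the diagonal matrix with entries $M_p+M_qd+M_rd^*+M_wdd^*$ and $M_{p'}+M_{q'}d^*+M_{r'}d+M_{w'}d^*d$; and under these isomorphisms the differential $\widetilde d$ becomes $$\delta(a,b)=\bigl(d(b),\,b-a,\,d^*(a),\,a-b\bigr)\ \text{ in degree }0,\qquad \delta(a,b,c,e)=(b+e,\,b+e)\ \text{ in degree }1.$$ The cohomologies $\widetilde{H^k}=\ker\delta/\operatorname{im}\delta$ of the complex $(\Omega_D^\bullet(\widetilde{\mathcal{A}_\theta}),\delta)$ satisfy, as complex vector spaces, $$\widetilde{H^0}\cong\mathbb{C},\qquad \widetilde{H^1}\cong\mathbb{C}\oplus\mathbb{C}\oplus\mathcal{A}_\theta/\mathbb{C}.$$ In particular $\widetilde{H^1}\neq0$, so the complex is cohomologically nontrivial. -/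

import Mathlib

open scoped TensorProduct ENNReal

noncomputable section

/-! ## Algebraic spectral triples and Connes' calculus -/

namespace Connes

universe u v

/-- The scalars `ℂ · 1` inside a unital algebra. -/
def scalars (A : Type u) [Ring A] [Algebra ℂ A] : Submodule ℂ A := Submodule.span ℂ {1}

/-- `A / ℂ`. -/
abbrev Abar (A : Type u) [Ring A] [Algebra ℂ A] : Type u := A ⧸ scalars A

/-- The `k`-forms `A ⊗ (A/ℂ)^{⊗k}` of the reduced universal differential graded algebra. -/
abbrev UForms (A : Type u) [Ring A] [Algebra ℂ A] (k : ℕ) : Type u :=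
  A ⊗[ℂ] (⨂[ℂ] _ : Fin k, Abar A)

section universal

variable (A : Type u) [Ring A] [Algebra ℂ A]

/-- `a ⊗ (t₁ ⊗ … ⊗ t_k) ↦ a ⊗ t₁ ⊗ … ⊗ t_k` on tensor powers of `A / ℂ`. -/
def consT (k : ℕ) :
    Abar A →ₗ[ℂ] (⨂[ℂ] _ : Fin k, Abar A) →ₗ[ℂ] (⨂[ℂ] _ : Fin (k + 1), Abar A) :=
  (PiTensorProduct.lift (R := ℂ) (s := fun _ : Fin k => Abar A)
      (E := ⨂[ℂ] _ : Fin (k + 1), Abar A)).toLinearMap ∘ₗ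
    (PiTensorProduct.tprod ℂ (s := fun _ : Fin (k + 1) => Abar A)).curryLeft

/-- The universal differential `a₀ ⊗ ā₁ ⊗ … ⊗ ā_k ↦ 1 ⊗ ā₀ ⊗ ā₁ ⊗ … ⊗ ā_k`. -/
def ud (k : ℕ) : UForms A k →ₗ[ℂ] UForms A (k + 1) :=
  TensorProduct.mk ℂ A (⨂[ℂ] _ : Fin (k + 1), Abar A) 1 ∘ₗ
    TensorProduct.lift (consT A k ∘ₗ (scalars A).mkQ)

variable {A}

theorem ud_tmul_tprod (k : ℕ) (a : A) (t : Fin k → Abar A) :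
    ud A k (a ⊗ₜ PiTensorProduct.tprod ℂ t) =
      1 ⊗ₜ PiTensorProduct.tprod ℂ (Fin.cons (α := fun _ => Abar A) ((scalars A).mkQ a) t) := by
  simp [ud, consT]

theorem ud_ud (k : ℕ) (ω : UForms A k) : ud A (k + 1) (ud A k ω) = 0 := by
  have h1 : (scalars A).mkQ (1 : A) = 0 := by
    rw [Submodule.mkQ_apply, Submodule.Quotient.mk_eq_zero]
    exact Submodule.mem_span_singleton_self 1
  have h2 : ∀ t, ud A (k + 1) ((1 : A) ⊗ₜ t) = 0 := by
    intro t
    simp [ud, h1]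
  exact h2 _

end universal

/-- An even algebraic spectral triple over `A` on `V`: a unital representation, an operator `D`
and a grading `γ` commuting with `A` and anticommuting with `D`. -/
structure EvenTriple (A : Type u) [Ring A] [Algebra ℂ A] (V : Type v) [AddCommGroup V]
    [Module ℂ V] where
  rep : A →ₐ[ℂ] Module.End ℂ V
  D : Module.End ℂ V
  γ : Module.End ℂ V
  γ_sq : γ * γ = 1
  γ_comm : ∀ a, γ * rep a = rep a * γ
  γ_anti : γ * D = -(D * γ)

namespace EvenTriple

variable {A : Type u} [Ring A] [Algebra ℂ A] {V : Type v} [AddCommGroup V] [Module ℂ V]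
  (T : EvenTriple A V)

/-- `ā ↦ [D, π(a)]`. -/
def comm : Abar A →ₗ[ℂ] Module.End ℂ V :=
  (scalars A).liftQ
    ((LinearMap.mulLeft ℂ T.D - LinearMap.mulRight ℂ T.D) ∘ₗ T.rep.toLinearMap)
    (by
      rw [scalars, Submodule.span_singleton_le_iff_mem]
      simp)

theorem comm_mk (a : A) :
    T.comm ((scalars A).mkQ a) = T.D * T.rep a - T.rep a * T.D := by
  simp [comm]

/-- The representation `a₀ ⊗ ā₁ ⊗ … ⊗ ā_k ↦ π(a₀)[D, π(a₁)] ⋯ [D, π(a_k)]` of universal forms. -/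
def repForms (k : ℕ) : UForms A k →ₗ[ℂ] Module.End ℂ V :=
  TensorProduct.lift
    ((LinearMap.mul ℂ (Module.End ℂ V)).compl₁₂ T.rep.toLinearMap
      (PiTensorProduct.lift
        ((MultilinearMap.mkPiAlgebraFin ℂ k (Module.End ℂ V)).compLinearMap (fun _ => T.comm))))

theorem repForms_tmul_tprod (k : ℕ) (a : A) (t : Fin k → Abar A) :
    T.repForms k (a ⊗ₜ PiTensorProduct.tprod ℂ t) =
      T.rep a * (List.ofFn fun i => T.comm (t i)).prod := by
  simp [repForms]

/-- `J₀^(k)`, the kernel of the representation in degree `k`. -/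
def J0 (k : ℕ) : Submodule ℂ (UForms A k) := LinearMap.ker (T.repForms k)

/-- `J^(k) = J₀^(k) + d J₀^(k-1)`, with `J^(0) = J₀^(0)`. -/
def J : (k : ℕ) → Submodule ℂ (UForms A k)
  | 0 => T.J0 0
  | k + 1 => T.J0 (k + 1) ⊔ (T.J0 k).map (ud A k)

theorem J0_le_J (k : ℕ) : T.J0 k ≤ T.J k := by
  cases k with
  | zero => exact le_rfl
  | succ k => exact le_sup_left

theorem J_le_comap (k : ℕ) : T.J k ≤ (T.J (k + 1)).comap (ud A k) := by
  have h0 : T.J0 k ≤ (T.J (k + 1)).comap (ud A k) :=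
    Submodule.map_le_iff_le_comap.mp le_sup_right
  cases k with
  | zero => exact h0
  | succ k =>
    refine sup_le h0 ?_
    rintro _ ⟨ω, -, rfl⟩
    rw [Submodule.mem_comap, ud_ud]
    exact zero_mem _

/-- Connes' forms `Ω_D^k(A) = Ω^k(A) / J^(k)`. -/
abbrev Forms (k : ℕ) : Type u := UForms A k ⧸ T.J k

/-- The differential of Connes' complex, induced by the universal differential. -/
def d (k : ℕ) : T.Forms k →ₗ[ℂ] T.Forms (k + 1) :=
  (T.J k).mapQ (T.J (k + 1)) (ud A k) (T.J_le_comap k)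

/-- The coboundaries in degree `k`: zero for `k = 0`, the range of `d` for `k > 0`. -/
def coboundaries : (k : ℕ) → Submodule ℂ (T.Forms k)
  | 0 => ⊥
  | k + 1 => LinearMap.range (T.d k)

/-- The cohomology `ker d / im d` of Connes' complex in degree `k`. -/
abbrev Cohomology (k : ℕ) : Type u :=
  LinearMap.ker (T.d k) ⧸ (T.coboundaries k).submoduleOf (LinearMap.ker (T.d k))

end EvenTriple

/-! ### Adjoining the grading to the algebra -/

/-- The vector space `A ⊕ A`, to be equipped with the product `⋆`. -/
@[ext]
structure Doubled (A : Type u) : Type u where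
  fst : A
  snd : A

namespace Doubled

variable {A : Type u}

/-- `A ⊕ A` as a set of pairs. -/
def equivProd : Doubled A ≃ A × A where
  toFun x := (x.fst, x.snd)
  invFun x := ⟨x.1, x.2⟩

variable [Ring A]

instance : AddCommGroup (Doubled A) := equivProd.addCommGroup
instance : One (Doubled A) := ⟨⟨1, 0⟩⟩

/-- `(a, b) ⋆ (a', b') = (aa' + bb', ab' + ba')`. -/
instance : Mul (Doubled A) :=
  ⟨fun x y => ⟨x.fst * y.fst + x.snd * y.snd, x.fst * y.snd + x.snd * y.fst⟩⟩

@[simp] theorem zero_fst : (0 : Doubled A).fst = 0 := rfl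
@[simp] theorem zero_snd : (0 : Doubled A).snd = 0 := rfl
@[simp] theorem one_fst : (1 : Doubled A).fst = 1 := rfl
@[simp] theorem one_snd : (1 : Doubled A).snd = 0 := rfl
@[simp] theorem add_fst (x y : Doubled A) : (x + y).fst = x.fst + y.fst := rfl
@[simp] theorem add_snd (x y : Doubled A) : (x + y).snd = x.snd + y.snd := rfl
@[simp] theorem mul_fst (x y : Doubled A) :
    (x * y).fst = x.fst * y.fst + x.snd * y.snd := rfl
@[simp] theorem mul_snd (x y : Doubled A) :
    (x * y).snd = x.fst * y.snd + x.snd * y.fst := rfl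

instance : Ring (Doubled A) where
  __ := (inferInstance : AddCommGroup (Doubled A))
  mul_assoc x y z := by ext <;> simp <;> noncomm_ring
  one_mul x := by ext <;> simp
  mul_one x := by ext <;> simp
  left_distrib x y z := by ext <;> simp <;> noncomm_ring
  right_distrib x y z := by ext <;> simp <;> noncomm_ring
  zero_mul x := by ext <;> simp
  mul_zero x := by ext <;> simp

variable [Algebra ℂ A]

instance : Module ℂ (Doubled A) := equivProd.module ℂ

@[simp] theorem smul_fst (c : ℂ) (x : Doubled A) : (c • x).fst = c • x.fst := rfl
@[simp] theorem smul_snd (c : ℂ) (x : Doubled A) : (c • x).snd = c • x.snd := rfl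

instance : Algebra ℂ (Doubled A) :=
  Algebra.ofModule
    (fun c x y => by ext <;> simp)
    (fun c x y => by ext <;> simp)

end Doubled

namespace EvenTriple

variable {A : Type u} [Ring A] [Algebra ℂ A] {V : Type v} [AddCommGroup V] [Module ℂ V]

/-- The triple over `(A ⊕ A, ⋆)` with representation `(a, b) ↦ π(a) + γ π(b)` and the same
space, operator and grading. -/
def double (T : EvenTriple A V) : EvenTriple (Doubled A) V where
  rep := AlgHom.ofLinearMap
    { toFun := fun x => T.rep x.fst + T.γ * T.rep x.snd
      map_add' := fun x y => by simp [mul_add]; abel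
      map_smul' := fun c x => by simp }
    (by simp)
    (fun x y => by
      have h : T.γ * T.rep x.snd * (T.γ * T.rep y.snd) = T.rep x.snd * T.rep y.snd := by
        rw [T.γ_comm, mul_assoc, ← mul_assoc T.γ T.γ, T.γ_sq, one_mul]
      have h' : T.rep x.fst * (T.γ * T.rep y.snd) = T.γ * (T.rep x.fst * T.rep y.snd) := by
        rw [← mul_assoc, ← T.γ_comm, mul_assoc]
      simp only [LinearMap.coe_mk, AddHom.coe_mk, Doubled.mul_fst, Doubled.mul_snd, map_add,
        map_mul, mul_add, add_mul, h, h']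
      rw [mul_assoc]
      abel)
  D := T.D
  γ := T.γ
  γ_sq := T.γ_sq
  γ_comm x := by
    have h : T.γ * (T.rep x.snd * T.γ) = T.rep x.snd * (T.γ * T.γ) := by
      rw [← mul_assoc, T.γ_comm, mul_assoc]
    simp [mul_add, add_mul, T.γ_comm, mul_assoc, h]
  γ_anti := T.γ_anti

end EvenTriple

end Connes

/-! ## The noncommutative torus -/

namespace NCTorus

/-- `e^{-2πiθ}`. -/
def phase (θ : ℝ) : ℂ := Complex.exp (-(2 * Real.pi * Complex.I * θ))

/-- A nonzero C⋆-algebra with unitaries `u`, `v` such that `uv = e^{-2πiθ} vu`. -/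
structure TorusPair (θ : ℝ) : Type 1 where
  B : Type
  [alg : CStarAlgebra B]
  [nontriv : Nontrivial B]
  u : B
  v : B
  u_mem : u ∈ unitary B
  v_mem : v ∈ unitary B
  rel : u * v = phase θ • (v * u)

attribute [instance] TorusPair.alg TorusPair.nontriv

/-- The bounded families indexed by all pairs of unitaries satisfying the relation. -/
abbrev Ambient (θ : ℝ) : Type 1 := lp (fun p : TorusPair θ => p.B) ∞

instance (θ : ℝ) : CStarAlgebra (Ambient θ) where

theorem memℓp_family {θ : ℝ} (w : ∀ p : TorusPair θ, p.B) (hw : ∀ p, w p ∈ unitary p.B) :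
    Memℓp w ∞ := by
  refine memℓp_infty ⟨1, ?_⟩
  rintro _ ⟨p, rfl⟩
  exact (CStarRing.norm_of_mem_unitary (hw p)).le

/-- The family of all `u`. -/
def ambU (θ : ℝ) : Ambient θ := ⟨fun p => p.u, memℓp_family _ fun p => p.u_mem⟩

/-- The family of all `v`. -/
def ambV (θ : ℝ) : Ambient θ := ⟨fun p => p.v, memℓp_family _ fun p => p.v_mem⟩

/-- The universal C⋆-algebra generated by two unitaries `U`, `V` with `UV = e^{-2πiθ} VU`: the
closed ⋆-subalgebra generated by the families of all `u` and of all `v`, so that its norm is the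
supremum of the norms in all pairs. The universal property is `existsUnique_lift`. -/
def torusSubalgebra (θ : ℝ) : StarSubalgebra ℂ (Ambient θ) :=
  (StarAlgebra.adjoin ℂ {ambU θ, ambV θ}).topologicalClosure

instance (θ : ℝ) : IsClosed (torusSubalgebra θ : Set (Ambient θ)) :=
  StarSubalgebra.isClosed_topologicalClosure _

/-- The C⋆-algebra of the noncommutative torus. -/
def Torus (θ : ℝ) : Type 1 := torusSubalgebra θ

instance (θ : ℝ) : CStarAlgebra (Torus θ) :=
  inferInstanceAs (CStarAlgebra (torusSubalgebra θ))

theorem ambU_mem_unitary (θ : ℝ) : ambU θ ∈ unitary (Ambient θ) := by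
  rw [Unitary.mem_iff]
  constructor <;> ext p
  · exact (Unitary.mem_iff.mp p.u_mem).1
  · exact (Unitary.mem_iff.mp p.u_mem).2

theorem ambV_mem_unitary (θ : ℝ) : ambV θ ∈ unitary (Ambient θ) := by
  rw [Unitary.mem_iff]
  constructor <;> ext p
  · exact (Unitary.mem_iff.mp p.v_mem).1
  · exact (Unitary.mem_iff.mp p.v_mem).2

/-- The unitary generator `U`. -/
def U (θ : ℝ) : unitary (Torus θ) :=
  ⟨(⟨ambU θ, StarSubalgebra.le_topologicalClosure _
      (StarAlgebra.subset_adjoin ℂ _ (Set.mem_insert _ _))⟩ : torusSubalgebra θ),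
    Unitary.mem_iff.mpr ⟨Subtype.ext (Unitary.mem_iff.mp (ambU_mem_unitary θ)).1,
      Subtype.ext (Unitary.mem_iff.mp (ambU_mem_unitary θ)).2⟩⟩

/-- The unitary generator `V`. -/
def V (θ : ℝ) : unitary (Torus θ) :=
  ⟨(⟨ambV θ, StarSubalgebra.le_topologicalClosure _
      (StarAlgebra.subset_adjoin ℂ _ (Set.mem_insert_of_mem _ rfl))⟩ : torusSubalgebra θ),
    Unitary.mem_iff.mpr ⟨Subtype.ext (Unitary.mem_iff.mp (ambV_mem_unitary θ)).1,
      Subtype.ext (Unitary.mem_iff.mp (ambV_mem_unitary θ)).2⟩⟩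

theorem U_mul_V (θ : ℝ) : (U θ : Torus θ) * V θ = phase θ • ((V θ : Torus θ) * U θ) := by
  refine Subtype.ext ?_
  ext p
  exact p.rel

/-- Evaluation at a pair. -/
def evalPair {θ : ℝ} (p : TorusPair θ) : Torus θ →⋆ₐ[ℂ] p.B where
  toFun x := x.1 p
  map_one' := rfl
  map_mul' _ _ := rfl
  map_zero' := rfl
  map_add' _ _ := rfl
  commutes' _ := rfl
  map_star' _ := rfl

/-- The universal property of the C⋆-algebra of the noncommutative torus. -/
theorem existsUnique_lift {θ : ℝ} {B : Type} [CStarAlgebra B] (u v : B) (hu : u ∈ unitary B)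
    (hv : v ∈ unitary B) (h : u * v = phase θ • (v * u)) :
    ∃! f : Torus θ →⋆ₐ[ℂ] B, f (U θ) = u ∧ f (V θ) = v := by
  have huniq : ∀ f g : Torus θ →⋆ₐ[ℂ] B, f (U θ) = u ∧ f (V θ) = v →
      g (U θ) = u ∧ g (V θ) = v → f = g := by
    intro f g hf hg
    have hc : ∀ k : Torus θ →⋆ₐ[ℂ] B, Continuous k := fun k =>
      AddMonoidHomClass.continuous_of_bound k 1 fun x => by
        simpa using NonUnitalStarAlgHom.norm_apply_le k x
    refine StarAlgHom.ext_topologicalClosure (hc f) (hc g) ?_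
    refine StarAlgHom.ext_adjoin ?_
    rintro ⟨x, hx⟩ hx'
    rcases hx' with rfl | hx'
    · exact hf.1.trans hg.1.symm
    · rw [Set.mem_singleton_iff] at hx'
      subst hx'
      exact hf.2.trans hg.2.symm
  rcases subsingleton_or_nontrivial B with hB | hB
  · refine ⟨{ toFun := fun _ => 0, map_one' := Subsingleton.elim _ _,
              map_mul' := fun _ _ => Subsingleton.elim _ _, map_zero' := rfl,
              map_add' := fun _ _ => Subsingleton.elim _ _,
              commutes' := fun _ => Subsingleton.elim _ _,
              map_star' := fun _ => Subsingleton.elim _ _ },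
      ⟨Subsingleton.elim _ _, Subsingleton.elim _ _⟩,
      fun g hg => huniq _ _ hg ⟨Subsingleton.elim _ _, Subsingleton.elim _ _⟩⟩
  · exact ⟨evalPair ⟨B, u, v, hu, hv, h⟩, ⟨rfl, rfl⟩, fun g hg => huniq _ _ hg ⟨rfl, rfl⟩⟩

/-- The unitary `U^{r₁} V^{r₂}`. -/
def W (θ : ℝ) (r : ℤ × ℤ) : Torus θ := ((U θ ^ r.1 * V θ ^ r.2 : unitary (Torus θ)) : Torus θ)

theorem norm_W_le (θ : ℝ) (r : ℤ × ℤ) : ‖W θ r‖ ≤ 1 := by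
  rcases subsingleton_or_nontrivial (Torus θ) with h | h
  · rw [Subsingleton.elim (W θ r) 0, norm_zero]
    exact zero_le_one
  · exact (CStarRing.norm_of_mem_unitary (U θ ^ r.1 * V θ ^ r.2 : unitary (Torus θ)).2).le

/-! ### The product of two monomials -/

theorem norm_phase (θ : ℝ) : ‖phase θ‖ = 1 := by
  rw [phase, show -(2 * (Real.pi : ℂ) * Complex.I * θ) = ((-(2 * Real.pi * θ) : ℝ) : ℂ) * Complex.I
    by push_cast; ring]
  exact Complex.norm_exp_ofReal_mul_I _

theorem phase_ne_zero (θ : ℝ) : phase θ ≠ 0 := Complex.exp_ne_zero _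

/-- The scalar `e^{-2πiθ}` as a unitary of the C⋆-algebra. -/
def Z (θ : ℝ) : unitary (Torus θ) :=
  ⟨phase θ • 1, by
    have h : star (phase θ) * phase θ = 1 := by
      rw [Complex.star_def, Complex.conj_mul', norm_phase]
      simp
    rw [Unitary.mem_iff, star_smul, star_one]
    constructor
    · rw [smul_mul_smul_comm, h, one_smul, one_mul]
    · rw [smul_mul_smul_comm, mul_comm, h, one_smul, one_mul]⟩

theorem Z_comm (θ : ℝ) (x : unitary (Torus θ)) : Commute (Z θ) x := by
  refine Subtype.ext ?_
  simp [Z]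

theorem coe_Z_zpow (θ : ℝ) (n : ℤ) : ((Z θ ^ n : unitary (Torus θ)) : Torus θ) = phase θ ^ n • 1 := by
  have h1 : ∀ n : ℕ, ((Z θ ^ n : unitary (Torus θ)) : Torus θ) = phase θ ^ n • 1 := by
    intro n
    simp [Z, smul_pow]
  have h2 : ∀ n : ℕ, (((Z θ ^ n)⁻¹ : unitary (Torus θ)) : Torus θ) = (phase θ ^ n)⁻¹ • 1 := by
    intro n
    have h3 : ((Z θ ^ n : unitary (Torus θ)) : Torus θ) *
        (((Z θ ^ n)⁻¹ : unitary (Torus θ)) : Torus θ) = 1 := by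
      rw [← Submonoid.coe_mul, mul_inv_cancel, Submonoid.coe_one]
    rw [h1, smul_one_mul] at h3
    rw [← h3, smul_smul, inv_mul_cancel₀ (pow_ne_zero n (phase_ne_zero θ)), one_smul]
  cases n with
  | ofNat n => simpa using h1 n
  | negSucc n => simpa only [zpow_negSucc] using h2 (n + 1)

theorem W_mul_W (θ : ℝ) (r s : ℤ × ℤ) :
    W θ r * W θ s = phase θ ^ (-(r.2 * s.1)) • W θ (r + s) := by
  have h0 : SemiconjBy (U θ) (V θ) (Z θ * V θ) := by
    refine Subtype.ext ?_
    have := U_mul_V θ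
    simpa [Z, mul_assoc] using this
  have h1 : SemiconjBy (V θ ^ r.2) (U θ) (Z θ ^ (-r.2) * U θ) := by
    have := h0.zpow_right r.2
    rw [SemiconjBy, (Z_comm θ (V θ)).mul_zpow] at this
    rw [SemiconjBy, mul_assoc, this, ← mul_assoc, ← mul_assoc, ← zpow_add]
    simp
  have h2 : V θ ^ r.2 * U θ ^ s.1 = Z θ ^ (-(r.2 * s.1)) * (U θ ^ s.1 * V θ ^ r.2) := by
    have := h1.zpow_right s.1
    rw [SemiconjBy, ((Z_comm θ (U θ)).zpow_left _).mul_zpow, ← zpow_mul, mul_assoc] at this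
    rw [this, neg_mul]
  have h3 : (U θ ^ r.1 * V θ ^ r.2) * (U θ ^ s.1 * V θ ^ s.2) =
      Z θ ^ (-(r.2 * s.1)) * (U θ ^ (r + s).1 * V θ ^ (r + s).2) := by
    calc (U θ ^ r.1 * V θ ^ r.2) * (U θ ^ s.1 * V θ ^ s.2)
        = U θ ^ r.1 * (V θ ^ r.2 * U θ ^ s.1) * V θ ^ s.2 := by simp only [mul_assoc]
      _ = (U θ ^ r.1 * Z θ ^ (-(r.2 * s.1))) * (U θ ^ s.1 * V θ ^ r.2) * V θ ^ s.2 := by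
          rw [h2]; simp only [mul_assoc]
      _ = (Z θ ^ (-(r.2 * s.1)) * U θ ^ r.1) * (U θ ^ s.1 * V θ ^ r.2) * V θ ^ s.2 := by
          rw [((Z_comm θ (U θ ^ r.1)).zpow_left _).eq]
      _ = _ := by
          rw [Prod.fst_add, Prod.snd_add, zpow_add, zpow_add]; simp only [mul_assoc]
  have hm : ∀ x y : unitary (Torus θ), ((x * y : unitary (Torus θ)) : Torus θ) = x * y :=
    fun _ _ => rfl
  have h4 := congrArg (fun x : unitary (Torus θ) => (x : Torus θ)) h3
  rw [hm (U θ ^ r.1 * V θ ^ r.2), hm (Z θ ^ _), coe_Z_zpow, smul_one_mul] at h4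
  exact h4

/-! ### Rapidly decreasing double sequences -/

/-- `1 + |r₁| + |r₂|`. -/
def wt (r : ℤ × ℤ) : ℝ := 1 + |(r.1 : ℝ)| + |(r.2 : ℝ)|

theorem one_le_wt (r : ℤ × ℤ) : 1 ≤ wt r := by
  have := abs_nonneg (r.1 : ℝ)
  have := abs_nonneg (r.2 : ℝ)
  unfold wt
  linarith

theorem wt_pos (r : ℤ × ℤ) : 0 < wt r := zero_lt_one.trans_le (one_le_wt r)

theorem wt_add_le (r s : ℤ × ℤ) : wt (r + s) ≤ wt r * wt s := by
  have h1 := abs_add_le (r.1 : ℝ) s.1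
  have h2 := abs_add_le (r.2 : ℝ) s.2
  have := abs_nonneg (r.1 : ℝ)
  have := abs_nonneg (r.2 : ℝ)
  have := abs_nonneg (s.1 : ℝ)
  have := abs_nonneg (s.2 : ℝ)
  simp only [wt, Prod.fst_add, Prod.snd_add, Int.cast_add]
  nlinarith [mul_nonneg (add_nonneg (abs_nonneg (r.1 : ℝ)) (abs_nonneg (r.2 : ℝ)))
    (add_nonneg (abs_nonneg (s.1 : ℝ)) (abs_nonneg (s.2 : ℝ)))]

/-- The space `S(ℤ²)` of double sequences decaying faster than the inverse of any polynomial. -/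
def Schwartz : Submodule ℂ (ℤ × ℤ → ℂ) where
  carrier := {a | ∀ k : ℕ, ∃ C : ℝ, ∀ r, wt r ^ k * ‖a r‖ ≤ C}
  zero_mem' k := ⟨0, fun r => by simp⟩
  add_mem' := by
    intro a b ha hb k
    obtain ⟨C, hC⟩ := ha k
    obtain ⟨C', hC'⟩ := hb k
    refine ⟨C + C', fun r => ?_⟩
    calc wt r ^ k * ‖a r + b r‖ ≤ wt r ^ k * (‖a r‖ + ‖b r‖) := by
          gcongr
          · exact pow_nonneg (wt_pos r).le k
          · exact norm_add_le _ _
      _ = wt r ^ k * ‖a r‖ + wt r ^ k * ‖b r‖ := by ring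
      _ ≤ C + C' := add_le_add (hC r) (hC' r)
  smul_mem' := by
    intro c a ha k
    obtain ⟨C, hC⟩ := ha k
    refine ⟨‖c‖ * C, fun r => ?_⟩
    calc wt r ^ k * ‖c • a r‖ = ‖c‖ * (wt r ^ k * ‖a r‖) := by rw [norm_smul]; ring
      _ ≤ ‖c‖ * C := mul_le_mul_of_nonneg_left (hC r) (norm_nonneg c)

theorem summable_wt : Summable fun r : ℤ × ℤ => (wt r ^ 4)⁻¹ := by
  have h1 : Summable fun n : ℤ => ((1 + |(n : ℝ)|) ^ 2)⁻¹ := by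
    refine Summable.of_nonneg_of_le (fun n => by positivity) (fun n => ?_)
      ((Real.summable_one_div_int_add_rpow (1 / 2) 2).mpr one_lt_two)
    have h2 : |(n : ℝ) + 1 / 2| ≤ 1 + |(n : ℝ)| := by
      have := abs_add_le (n : ℝ) (1 / 2)
      rw [abs_of_pos (by norm_num : (0 : ℝ) < 1 / 2)] at this
      linarith
    have h3 : 0 < |(n : ℝ) + 1 / 2| := by
      rw [abs_pos]
      intro h
      have h4 : ((2 * n + 1 : ℤ) : ℝ) = 0 := by push_cast; linarith
      have h5 : 2 * n + 1 = 0 := by exact_mod_cast h4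
      omega
    rw [one_div, Real.rpow_two]
    gcongr
  have h2 := h1.mul_of_nonneg h1 (fun n => by positivity) (fun n => by positivity)
  refine Summable.of_nonneg_of_le (fun r => inv_nonneg.mpr (pow_nonneg (wt_pos r).le 4))
    (fun r => ?_) h2
  rw [← mul_inv]
  have ha := abs_nonneg (r.1 : ℝ)
  have hb := abs_nonneg (r.2 : ℝ)
  have e1 : 1 + |(r.1 : ℝ)| ≤ wt r := by unfold wt; linarith
  have e2 : 1 + |(r.2 : ℝ)| ≤ wt r := by unfold wt; linarith
  refine inv_anti₀ (by positivity) ?_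
  calc (1 + |(r.1 : ℝ)|) ^ 2 * (1 + |(r.2 : ℝ)|) ^ 2 ≤ wt r ^ 2 * wt r ^ 2 := by
        gcongr
    _ = wt r ^ 4 := by ring

theorem summable_wt_mul_norm (a : Schwartz) (k : ℕ) :
    Summable fun r => wt r ^ k * ‖a.1 r‖ := by
  obtain ⟨C, hC⟩ := a.2 (k + 4)
  refine Summable.of_nonneg_of_le
    (fun r => mul_nonneg (pow_nonneg (wt_pos r).le k) (norm_nonneg _)) (fun r => ?_)
    (summable_wt.mul_left C)
  rw [← div_eq_mul_inv, le_div_iff₀ (pow_pos (wt_pos r) 4)]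
  calc wt r ^ k * ‖a.1 r‖ * wt r ^ 4 = wt r ^ (k + 4) * ‖a.1 r‖ := by ring
    _ ≤ C := hC r

theorem summable_norm (a : Schwartz) : Summable fun r => ‖a.1 r‖ := by
  simpa using summable_wt_mul_norm a 0

theorem summable_norm_smul_W (θ : ℝ) (a : Schwartz) : Summable fun r => ‖a.1 r • W θ r‖ := by
  refine Summable.of_nonneg_of_le (fun r => norm_nonneg _) (fun r => ?_) (summable_norm a)
  rw [norm_smul]
  exact mul_le_of_le_one_right (norm_nonneg _) (norm_W_le θ r)

theorem summable_smul_W (θ : ℝ) (a : Schwartz) : Summable fun r => a.1 r • W θ r :=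
  (summable_norm_smul_W θ a).of_norm

/-- `(a_r) ↦ ∑ a_{r₁,r₂} U^{r₁} V^{r₂}`, a norm convergent sum in the C⋆-algebra. -/
def sumW (θ : ℝ) : Schwartz →ₗ[ℂ] Torus θ where
  toFun a := ∑' r, a.1 r • W θ r
  map_add' a b := by
    rw [← (summable_smul_W θ a).tsum_add (summable_smul_W θ b)]
    simp [add_smul]
  map_smul' c a := by
    rw [RingHom.id_apply, ← (summable_smul_W θ a).tsum_const_smul c]
    simp [smul_smul]

theorem sumW_apply (θ : ℝ) (a : Schwartz) : sumW θ a = ∑' r, a.1 r • W θ r := rfl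

/-- The sequence with the value `c` at the origin and zero elsewhere. -/
def deltaS (c : ℂ) : Schwartz :=
  ⟨Pi.single 0 c, fun k => ⟨‖c‖, fun r => by
    by_cases h : r = 0
    · subst h
      simp [wt]
    · simp [Pi.single_eq_of_ne h]⟩⟩

theorem sumW_deltaS (θ : ℝ) (c : ℂ) : sumW θ (deltaS c) = algebraMap ℂ (Torus θ) c := by
  change ∑' r, (Pi.single 0 c : ℤ × ℤ → ℂ) r • W θ r = _
  rw [tsum_eq_single 0 fun r h => by simp [Pi.single_eq_of_ne h]]
  simp [W, Algebra.algebraMap_eq_smul_one]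

/-- The twisted convolution of coefficient sequences. -/
def convFun (θ : ℝ) (a b : ℤ × ℤ → ℂ) (n : ℤ × ℤ) : ℂ :=
  ∑' r, phase θ ^ (-(r.2 * (n - r).1)) * (a r * b (n - r))

theorem norm_phase_zpow (θ : ℝ) (k : ℤ) : ‖phase θ ^ k‖ = 1 := by
  rw [norm_zpow, norm_phase, one_zpow]

theorem convFun_term_le (θ : ℝ) (a b : Schwartz) (k : ℕ) {C : ℝ}
    (hC : ∀ r, wt r ^ k * ‖b.1 r‖ ≤ C) (n r : ℤ × ℤ) :
    wt n ^ k * ‖phase θ ^ (-(r.2 * (n - r).1)) * (a.1 r * b.1 (n - r))‖ ≤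
      wt r ^ k * ‖a.1 r‖ * C := by
  have h1 : wt n ≤ wt r * wt (n - r) := by
    simpa using wt_add_le r (n - r)
  rw [norm_mul, norm_phase_zpow, one_mul, norm_mul]
  have h0 := (wt_pos n).le
  have h2 := (wt_pos r).le
  calc wt n ^ k * (‖a.1 r‖ * ‖b.1 (n - r)‖)
      ≤ (wt r * wt (n - r)) ^ k * (‖a.1 r‖ * ‖b.1 (n - r)‖) := by gcongr
    _ = wt r ^ k * ‖a.1 r‖ * (wt (n - r) ^ k * ‖b.1 (n - r)‖) := by rw [mul_pow]; ring
    _ ≤ wt r ^ k * ‖a.1 r‖ * C := by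
        gcongr
        exact hC _

theorem summable_convFun (θ : ℝ) (a b : Schwartz) (n : ℤ × ℤ) :
    Summable fun r => ‖phase θ ^ (-(r.2 * (n - r).1)) * (a.1 r * b.1 (n - r))‖ := by
  obtain ⟨C, hC⟩ := b.2 0
  refine Summable.of_nonneg_of_le (fun r => norm_nonneg _) (fun r => ?_)
    ((summable_wt_mul_norm a 0).mul_right C)
  simpa using convFun_term_le θ a b 0 hC n r

/-- The twisted convolution of rapidly decreasing sequences. -/
def conv (θ : ℝ) (a b : Schwartz) : Schwartz :=
  ⟨convFun θ a.1 b.1, fun k => by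
    obtain ⟨C, hC⟩ := b.2 k
    refine ⟨∑' r, wt r ^ k * ‖a.1 r‖ * C, fun n => ?_⟩
    have hs := summable_convFun θ a b n
    calc wt n ^ k * ‖convFun θ a.1 b.1 n‖
        ≤ wt n ^ k * ∑' r, ‖phase θ ^ (-(r.2 * (n - r).1)) * (a.1 r * b.1 (n - r))‖ :=
          mul_le_mul_of_nonneg_left (norm_tsum_le_tsum_norm hs) (pow_nonneg (wt_pos n).le k)
      _ = ∑' r, wt n ^ k * ‖phase θ ^ (-(r.2 * (n - r).1)) * (a.1 r * b.1 (n - r))‖ :=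
          tsum_mul_left.symm
      _ ≤ ∑' r, wt r ^ k * ‖a.1 r‖ * C :=
          (hs.mul_left _).tsum_le_tsum (convFun_term_le θ a b k hC n)
            ((summable_wt_mul_norm a k).mul_right C)⟩

/-- `(n, r) ↦ (r, n - r)`. -/
def shear : (ℤ × ℤ) × (ℤ × ℤ) ≃ (ℤ × ℤ) × (ℤ × ℤ) where
  toFun p := (p.2, p.1 - p.2)
  invFun p := (p.1 + p.2, p.1)
  left_inv p := by simp
  right_inv p := by simp

theorem smul_W_mul_smul_W (θ : ℝ) (a b : Schwartz) (n r : ℤ × ℤ) :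
    (a.1 r • W θ r) * (b.1 (n - r) • W θ (n - r)) =
      (phase θ ^ (-(r.2 * (n - r).1)) * (a.1 r * b.1 (n - r))) • W θ n := by
  rw [smul_mul_smul_comm, W_mul_W, smul_smul, mul_comm (a.1 r * _), add_sub_cancel]

theorem sumW_mul_sumW (θ : ℝ) (a b : Schwartz) :
    sumW θ a * sumW θ b = sumW θ (conv θ a b) := by
  have hs := summable_mul_of_summable_norm (summable_norm_smul_W θ a) (summable_norm_smul_W θ b)
  have hs' := shear.summable_iff.mpr hs
  have h1 : sumW θ a * sumW θ b =
      ∑' p : (ℤ × ℤ) × (ℤ × ℤ), (a.1 p.1 • W θ p.1) * (b.1 p.2 • W θ p.2) :=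
    tsum_mul_tsum_of_summable_norm (summable_norm_smul_W θ a) (summable_norm_smul_W θ b)
  have h2 := shear.tsum_eq
    (fun p : (ℤ × ℤ) × (ℤ × ℤ) => (a.1 p.1 • W θ p.1) * (b.1 p.2 • W θ p.2))
  rw [h1, ← h2]
  refine hs'.tsum_prod.trans ?_
  rw [sumW_apply]
  refine tsum_congr fun n => ?_
  have h3 := (summable_convFun θ a b n).of_norm.tsum_smul_const (W θ n)
  refine Eq.trans ?_ h3
  exact tsum_congr fun r => smul_W_mul_smul_W θ a b n r

/-! ### The coefficients of a smooth element are determined by it -/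

/-- `ℓ²(ℤ²)`. -/
abbrev Hilb : Type := lp (fun _ : ℤ × ℤ => ℂ) 2

/-- The weighted translation `f ↦ (r ↦ c r * f (e r))`, where `|c r| = 1`, on `ℓ²(ℤ²)`. -/
def wshift (e : ℤ × ℤ ≃ ℤ × ℤ) (c : ℤ × ℤ → ℂ) (hc : ∀ r, ‖c r‖ = 1) (f : Hilb) : Hilb :=
  ⟨fun r => c r * f (e r), by
    have h := (lp.memℓp f).summable (by norm_num)
    refine memℓp_gen ?_
    simp only [norm_mul, hc, one_mul]
    exact e.summable_iff.mpr h⟩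

theorem wshift_apply (e : ℤ × ℤ ≃ ℤ × ℤ) (c : ℤ × ℤ → ℂ) (hc : ∀ r, ‖c r‖ = 1) (f : Hilb)
    (r : ℤ × ℤ) : wshift e c hc f r = c r * f (e r) := rfl

/-- The weighted translation as a unitary operator. -/
def wshiftIso (e : ℤ × ℤ ≃ ℤ × ℤ) (c : ℤ × ℤ → ℂ) (hc : ∀ r, ‖c r‖ = 1) :
    Hilb ≃ₗᵢ[ℂ] Hilb where
  toFun := wshift e c hc
  invFun := wshift e.symm (fun r => (c (e.symm r))⁻¹) (fun r => by simp [hc])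
  map_add' f g := by
    ext r
    simp [wshift_apply, mul_add]
  map_smul' z f := by
    ext r
    simp [wshift_apply, mul_left_comm]
  left_inv f := by
    ext r
    have h : c (e.symm r) ≠ 0 := norm_ne_zero_iff.mp (by rw [hc]; exact one_ne_zero)
    simp only [wshift_apply, Equiv.apply_symm_apply]
    exact inv_mul_cancel_left₀ h (f r)
  right_inv f := by
    ext r
    have h : c r ≠ 0 := norm_ne_zero_iff.mp (by rw [hc]; exact one_ne_zero)
    simp only [wshift_apply, Equiv.symm_apply_apply]
    exact mul_inv_cancel_left₀ h (f r)
  norm_map' f := by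
    have h2 : 0 < (2 : ℝ≥0∞).toReal := by norm_num
    change ‖wshift e c hc f‖ = ‖f‖
    rw [lp.norm_eq_tsum_rpow h2, lp.norm_eq_tsum_rpow h2]
    simp only [wshift_apply, norm_mul, hc, one_mul]
    rw [e.tsum_eq (fun r => ‖f r‖ ^ (2 : ℝ≥0∞).toReal)]

/-- The weighted translation as an element of the unitary group. -/
def wshiftU (e : ℤ × ℤ ≃ ℤ × ℤ) (c : ℤ × ℤ → ℂ) (hc : ∀ r, ‖c r‖ = 1) :
    unitary (Hilb →L[ℂ] Hilb) :=
  Unitary.linearIsometryEquiv.symm (wshiftIso e c hc)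

theorem wshiftU_apply (e : ℤ × ℤ ≃ ℤ × ℤ) (c : ℤ × ℤ → ℂ) (hc : ∀ r, ‖c r‖ = 1) (f : Hilb)
    (r : ℤ × ℤ) : (wshiftU e c hc : Hilb →L[ℂ] Hilb) f r = c r * f (e r) := rfl

/-- `U` acts by `e_{m,n} ↦ e_{m+1,n}`. -/
def regU : unitary (Hilb →L[ℂ] Hilb) :=
  wshiftU (Equiv.subRight (1, 0)) (fun _ => 1) (fun _ => norm_one)

/-- `V` acts by `e_{m,n} ↦ e^{2πiθm} e_{m,n+1}`. -/
def regV (θ : ℝ) : unitary (Hilb →L[ℂ] Hilb) :=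
  wshiftU (Equiv.subRight (0, 1)) (fun r => phase θ ^ (-r.1)) (fun _ => norm_phase_zpow θ _)

theorem regU_mul_regV (θ : ℝ) :
    (regU : Hilb →L[ℂ] Hilb) * regV θ = phase θ • ((regV θ : Hilb →L[ℂ] Hilb) * regU) := by
  ext f r
  change (1 : ℂ) * (phase θ ^ (-(r - (1, 0)).1) * f (r - (1, 0) - (0, 1))) =
    phase θ * (phase θ ^ (-r.1) * ((1 : ℂ) * f (r - (0, 1) - (1, 0))))
  rw [sub_right_comm, ← mul_assoc (phase θ), ← zpow_one_add₀ (phase_ne_zero θ)]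
  have : -(r - (1, 0)).1 = 1 + -r.1 := by
    simp
    ring
  rw [this, one_mul, one_mul]

/-- The orthonormal basis of `ℓ²(ℤ²)`. -/
def basisVec (r : ℤ × ℤ) : Hilb := lp.single 2 r 1

theorem basisVec_apply (r s : ℤ × ℤ) : basisVec r s = if s = r then 1 else 0 := by
  rw [basisVec, lp.single_apply, Pi.single_apply]

theorem regU_basisVec (r : ℤ × ℤ) :
    (regU : Hilb →L[ℂ] Hilb) (basisVec r) = basisVec (r + (1, 0)) := by
  ext s
  change (1 : ℂ) * basisVec r (s - (1, 0)) = _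
  rw [basisVec_apply, basisVec_apply, one_mul]
  simp only [sub_eq_iff_eq_add]

theorem regV_basisVec (θ : ℝ) (n : ℤ) :
    (regV θ : Hilb →L[ℂ] Hilb) (basisVec (0, n)) = basisVec (0, n + 1) := by
  ext s
  change phase θ ^ (-s.1) * basisVec (0, n) (s - (0, 1)) = _
  have h : (s - (0, 1) = (0, n)) ↔ s = (0, n + 1) := by
    rw [sub_eq_iff_eq_add]
    simp
  rw [basisVec_apply, basisVec_apply]
  by_cases hs : s = (0, n + 1)
  · subst hs
    simp
  · simp [h, hs]

theorem zpow_orbit (T : unitary (Hilb →L[ℂ] Hilb)) (g : ℤ → Hilb)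
    (h : ∀ k, (T : Hilb →L[ℂ] Hilb) (g k) = g (k + 1)) (n k : ℤ) :
    ((T ^ n : unitary (Hilb →L[ℂ] Hilb)) : Hilb →L[ℂ] Hilb) (g k) = g (k + n) := by
  have hm : ∀ x y : unitary (Hilb →L[ℂ] Hilb), ∀ f : Hilb,
      ((x * y : unitary (Hilb →L[ℂ] Hilb)) : Hilb →L[ℂ] Hilb) f =
        (x : Hilb →L[ℂ] Hilb) ((y : Hilb →L[ℂ] Hilb) f) := fun _ _ _ => rfl
  have h' : ∀ k, ((T⁻¹ : unitary (Hilb →L[ℂ] Hilb)) : Hilb →L[ℂ] Hilb) (g k) = g (k - 1) := by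
    intro k
    have h1 := h (k - 1)
    rw [sub_add_cancel] at h1
    rw [← h1, ← hm, inv_mul_cancel]
    rfl
  induction n generalizing k with
  | zero => simp
  | succ n ih => rw [zpow_add_one, hm, h, ih]; congr 1; ring
  | pred n ih => rw [zpow_sub_one, hm, h', ih]; congr 1; ring

/-- The regular representation of the noncommutative torus on `ℓ²(ℤ²)`. -/
theorem exists_regular (θ : ℝ) :
    ∃ f : Torus θ →⋆ₐ[ℂ] (Hilb →L[ℂ] Hilb), ∀ r, f (W θ r) (basisVec 0) = basisVec r := by
  obtain ⟨f, ⟨hU, hV⟩, -⟩ := existsUnique_lift (θ := θ) (regU : Hilb →L[ℂ] Hilb)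
    (regV θ : Hilb →L[ℂ] Hilb) regU.2 (regV θ).2 (regU_mul_regV θ)
  refine ⟨f, fun r => ?_⟩
  let g : Torus θ →⋆* (Hilb →L[ℂ] Hilb) :=
    { toFun := f, map_one' := map_one f, map_mul' := map_mul f, map_star' := map_star f }
  have h1 : Unitary.map g (U θ) = regU := Subtype.ext hU
  have h2 : Unitary.map g (V θ) = regV θ := Subtype.ext hV
  have h3 : f (W θ r) =
      ((Unitary.map g (U θ ^ r.1 * V θ ^ r.2) : unitary (Hilb →L[ℂ] Hilb)) : Hilb →L[ℂ] Hilb) := rfl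
  rw [h3, map_mul, map_zpow, map_zpow, h1, h2]
  change ((regU ^ r.1 : unitary (Hilb →L[ℂ] Hilb)) : Hilb →L[ℂ] Hilb)
    (((regV θ ^ r.2 : unitary (Hilb →L[ℂ] Hilb)) : Hilb →L[ℂ] Hilb) (basisVec 0)) = basisVec r
  have h4 := zpow_orbit (regV θ) (fun n => basisVec (0, n)) (regV_basisVec θ) r.2 0
  have h5 := zpow_orbit regU (fun m => basisVec (m, r.2))
    (fun k => by simpa using regU_basisVec (k, r.2)) r.1 0
  simp only [zero_add] at h4 h5
  rw [show (0 : ℤ × ℤ) = (0, 0) from rfl, h4, h5]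

theorem sumW_injective (θ : ℝ) : Function.Injective (sumW θ) := by
  rw [← LinearMap.ker_eq_bot, LinearMap.ker_eq_bot']
  intro a ha
  obtain ⟨f, hf⟩ := exists_regular θ
  have hc : Continuous f := AddMonoidHomClass.continuous_of_bound f 1 fun x => by
    simpa using NonUnitalStarAlgHom.norm_apply_le f x
  refine Subtype.ext (funext fun s => ?_)
  have h1 := (summable_smul_W θ a).hasSum
  rw [← sumW_apply, ha] at h1
  have h2 := h1.map (f : Torus θ →+ (Hilb →L[ℂ] Hilb)) hc
  have h3 := ((lp.evalCLM ℂ (fun _ : ℤ × ℤ => ℂ) 2 s).comp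
    (ContinuousLinearMap.apply ℂ Hilb (basisVec 0))).hasSum h2
  have h7 : ∀ r, a.1 r * basisVec r s = (f (a.1 r • W θ r) (basisVec 0)) s := fun r => by
    rw [← hf r, map_smul]
    rfl
  have h4 : HasSum (fun r => a.1 r * basisVec r s) 0 := by
    simp only [h7]
    have h8 : (f (0 : Torus θ) (basisVec 0)) s = 0 := by
      rw [map_zero]
      rfl
    rw [← h8]
    exact h3
  have h5 : HasSum (fun r => a.1 r * basisVec r s) (a.1 s * basisVec s s) := by
    refine hasSum_single s fun r hr => ?_
    rw [basisVec_apply, if_neg (Ne.symm hr), mul_zero]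
  have h6 := h5.unique h4
  rw [basisVec_apply, if_pos rfl, mul_one] at h6
  exact h6

/-! ### The smooth algebra, its derivations and its spectral triple -/

/-- The smooth subalgebra of all `∑ a_{r₁,r₂} U^{r₁} V^{r₂}` with rapidly decreasing
coefficients. -/
def Smooth (θ : ℝ) : Subalgebra ℂ (Torus θ) where
  carrier := Set.range (sumW θ)
  mul_mem' := by
    rintro _ _ ⟨a, rfl⟩ ⟨b, rfl⟩
    exact ⟨conv θ a b, (sumW_mul_sumW θ a b).symm⟩
  add_mem' := by
    rintro _ _ ⟨a, rfl⟩ ⟨b, rfl⟩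
    exact ⟨a + b, map_add _ _ _⟩
  algebraMap_mem' c := ⟨deltaS c, sumW_deltaS θ c⟩

/-- The identification of rapidly decreasing sequences with smooth elements. -/
def smoothEquiv (θ : ℝ) : Schwartz ≃ₗ[ℂ] Smooth θ :=
  LinearEquiv.ofBijective
    ((sumW θ).codRestrict (Subalgebra.toSubmodule (Smooth θ)) (fun a => ⟨a, rfl⟩) :
      Schwartz →ₗ[ℂ] Subalgebra.toSubmodule (Smooth θ))
    ⟨fun _ _ h => sumW_injective θ (congrArg Subtype.val h),
      fun ⟨_, a, ha⟩ => ⟨a, Subtype.ext ha⟩⟩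

theorem coe_smoothEquiv (θ : ℝ) (a : Schwartz) :
    (smoothEquiv θ a : Torus θ) = ∑' r, a.1 r • W θ r := rfl

/-- Multiplication of a rapidly decreasing sequence by a weight of linear growth. -/
def mulWeight (w : ℤ × ℤ → ℂ) (hw : ∀ r, ‖w r‖ ≤ wt r) : Schwartz →ₗ[ℂ] Schwartz where
  toFun a := ⟨fun r => w r * a.1 r, by
    intro k
    obtain ⟨C, hC⟩ := a.2 (k + 1)
    refine ⟨C, fun r => le_trans ?_ (hC r)⟩
    rw [norm_mul, pow_succ, mul_assoc]
    have := wt_pos r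
    gcongr
    exact hw r⟩
  map_add' := by
    intro a b
    exact Subtype.ext (funext fun r => mul_add (w r) (a.1 r) (b.1 r))
  map_smul' := by
    intro c a
    exact Subtype.ext (funext fun r => mul_left_comm (w r) c (a.1 r))

/-- `δ₁ (∑ a_r U^{r₁} V^{r₂}) = ∑ r₁ a_r U^{r₁} V^{r₂}`. -/
def δ₁ (θ : ℝ) : Smooth θ →ₗ[ℂ] Smooth θ :=
  (smoothEquiv θ).toLinearMap ∘ₗ
    mulWeight (fun r => (r.1 : ℂ)) (fun r => by
      rw [Complex.norm_intCast]
      have := abs_nonneg (r.2 : ℝ)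
      unfold wt
      linarith) ∘ₗ (smoothEquiv θ).symm.toLinearMap

/-- `δ₂ (∑ a_r U^{r₁} V^{r₂}) = ∑ r₂ a_r U^{r₁} V^{r₂}`. -/
def δ₂ (θ : ℝ) : Smooth θ →ₗ[ℂ] Smooth θ :=
  (smoothEquiv θ).toLinearMap ∘ₗ
    mulWeight (fun r => (r.2 : ℂ)) (fun r => by
      rw [Complex.norm_intCast]
      have := abs_nonneg (r.1 : ℝ)
      unfold wt
      linarith) ∘ₗ (smoothEquiv θ).symm.toLinearMap

/-- `d = δ₁ - i δ₂`. -/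
def dd (θ : ℝ) : Smooth θ →ₗ[ℂ] Smooth θ := δ₁ θ - Complex.I • δ₂ θ

/-- `d* = δ₁ + i δ₂`. -/
def ddStar (θ : ℝ) : Smooth θ →ₗ[ℂ] Smooth θ := δ₁ θ + Complex.I • δ₂ θ

/-- The even algebraic spectral triple of the noncommutative torus: the smooth algebra acts
diagonally on two copies of itself by left multiplication, `D(x, y) = (d y, d* x)` and
`γ(x, y) = (x, -y)`. -/
def triple (θ : ℝ) : Connes.EvenTriple (Smooth θ) (Smooth θ × Smooth θ) where
  rep := Algebra.lsmul ℂ ℂ (Smooth θ × Smooth θ)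
  D := (dd θ ∘ₗ LinearMap.snd ℂ _ _).prod (ddStar θ ∘ₗ LinearMap.fst ℂ _ _)
  γ := (LinearMap.fst ℂ _ _).prod (-LinearMap.snd ℂ _ _)
  γ_sq := by
    refine LinearMap.ext fun x => ?_
    simp
  γ_comm a := by
    refine LinearMap.ext fun x => ?_
    simp
  γ_anti := by
    refine LinearMap.ext fun x => ?_
    simp

/-- The triple over `(A ⊕ A, ⋆)` obtained from that of the noncommutative torus by adjoining the
grading to the algebra. -/
def doubledTriple (θ : ℝ) :
    Connes.EvenTriple (Connes.Doubled (Smooth θ)) (Smooth θ × Smooth θ) :=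
  (triple θ).double

end NCTorus

end

noncomputable section

namespace Connes

universe u

namespace Doubled

variable {A : Type u} [Ring A] [Algebra ℂ A]

/-! Write ∂ and ∂' for d and d*. In the components p = a + b and m = a - b, the doubled algebra is A
× A, acting by independent left multiplications on the even and odd halves. By the Leibniz rule [D,
(p, m)] has off-diagonal entries ∂m + (m - p)∂ and ∂'p + (p - m)∂'. Since m and p need not agree,
genuine differential operators appear, and this is what changes the calculus. Forms of degree 1 and
2 become operators of order at most 1 and 2, and their coefficients are determined by the values on
1, u, u⁻¹ and v (`op₁_injective`, `opHalf_injective`).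

The representation is faithful in degree 0, so there is no extra junk in degree 1, and all four
coefficients occur (`symbol₁_surjective`). In degree 2 the junk consists exactly of the operators
without second-order term (`J_two`). One inclusion comes from `principal_ud`: the leading
coefficients of dω are both b + e, where b and e are the first-order coefficients of ω, so they
vanish when ω is represented by zero. The other comes from explicit 1-forms represented by zero
(`mem_junk_of_principal_eq_zero`), built from the conjugation z⁻¹∂z = ∂ + e for an eigenvector z.
The same formula for dω gives the differential in degree 1.

The cohomology is then Fourier analysis. The derivations multiply coefficients by r₁ ∓ i r₂, of
modulus at least 1 off the origin, so they are invertible on elements of mean zero and kill only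
constants. A cocycle (a, b, c, -b) is exact iff ∂a' = a - ∂b and ∂'a' = c have a common solution.
The obstructions are the means of a - ∂b and c, and the compatibility defect ∂'(a - ∂b) - ∂c. The
defect always has mean zero, so nothing is lost by taking it in A/ℂ (`exists_of_classMap_eq_zero`),
and all obstruction values occur (`exists_classMap_eq`). -/

/-- The algebra `A ⊕ A` acts on the even part through `(a, b) ↦ a + b`. -/
def plus : Doubled A →ₗ[ℂ] A where
  toFun x := x.fst + x.snd
  map_add' x y := by simp; abel
  map_smul' c x := by simp

/-- The algebra `A ⊕ A` acts on the odd part through `(a, b) ↦ a - b`. -/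
def minus : Doubled A →ₗ[ℂ] A where
  toFun x := x.fst - x.snd
  map_add' x y := by simp; abel
  map_smul' c x := by simp [smul_sub]

theorem plus_apply (x : Doubled A) : plus x = x.fst + x.snd := rfl

theorem minus_apply (x : Doubled A) : minus x = x.fst - x.snd := rfl

/-- The element of `A ⊕ A` with given even and odd components. -/
def pair (a b : A) : Doubled A := ⟨(2⁻¹ : ℂ) • (a + b), (2⁻¹ : ℂ) • (a - b)⟩

@[simp] theorem plus_pair (a b : A) : plus (pair a b) = a := by
  rw [plus_apply, pair]
  module

@[simp] theorem minus_pair (a b : A) : minus (pair a b) = b := by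
  rw [minus_apply, pair]
  module

theorem pair_plus_minus (x : Doubled A) : pair (plus x) (minus x) = x := by
  ext <;> simp only [plus_apply, minus_apply, pair] <;> module

end Doubled

/-! ### Abstract derivation pairs and the coefficients of differential operators -/

/-- Two derivations of an algebra with common invertible eigenvectors `u`, `v` whose eigenvalues
are `(1, 1)` and `(c, -c)`, where `c ≠ 0`. -/
structure DerivationPair (A : Type u) [Ring A] [Algebra ℂ A] where
  del : A →ₗ[ℂ] A
  del' : A →ₗ[ℂ] A
  del_mul : ∀ a b, del (a * b) = del a * b + a * del b
  del'_mul : ∀ a b, del' (a * b) = del' a * b + a * del' b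
  u : Aˣ
  v : Aˣ
  c : ℂ
  c_ne_zero : c ≠ 0
  del_u : del u = u
  del'_u : del' u = u
  del_v : del v = c • (v : A)
  del'_v : del' v = -(c • (v : A))

namespace DerivationPair

open Doubled

variable {A : Type u} [Ring A] [Algebra ℂ A] (S : DerivationPair A)

/-- The same derivations in the opposite order. -/
def swap : DerivationPair A where
  del := S.del'
  del' := S.del
  del_mul := S.del'_mul
  del'_mul := S.del_mul
  u := S.u
  v := S.v
  c := -S.c
  c_ne_zero := neg_ne_zero.mpr S.c_ne_zero
  del_u := S.del'_u
  del'_u := S.del_u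
  del_v := by rw [S.del'_v, neg_smul]
  del'_v := by rw [S.del_v, neg_smul, neg_neg]

@[simp] theorem swap_del : S.swap.del = S.del' := rfl
@[simp] theorem swap_del' : S.swap.del' = S.del := rfl

@[simp] theorem del_one : S.del 1 = 0 := by
  have h := S.del_mul 1 1
  simpa using h

@[simp] theorem del'_one : S.del' 1 = 0 := S.swap.del_one

/-- Differentiate z z⁻¹ = 1 and cancel z on the left. -/
theorem del_inv_of_eigen {z : Aˣ} {e : ℂ} (h : S.del z = e • (z : A)) :
    S.del (z⁻¹ : Aˣ) = -(e • ((z⁻¹ : Aˣ) : A)) := by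
  have h1 := S.del_mul z (z⁻¹ : Aˣ)
  rw [Units.mul_inv, del_one, h, smul_mul_assoc, Units.mul_inv] at h1
  have h2 := congrArg (fun x => ((z⁻¹ : Aˣ) : A) * x) h1
  simp only [mul_zero, mul_add, mul_smul_comm, mul_one, Units.inv_mul_cancel_left] at h2
  rw [eq_neg_iff_add_eq_zero, add_comm]
  exact h2.symm

theorem del_u_inv : S.del (S.u⁻¹ : Aˣ) = -((S.u⁻¹ : Aˣ) : A) := by
  simpa using S.del_inv_of_eigen (z := S.u) (e := 1) (by rw [one_smul, S.del_u])

theorem del'_u_inv : S.del' (S.u⁻¹ : Aˣ) = -((S.u⁻¹ : Aˣ) : A) := S.swap.del_u_inv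

/-- The even triple on `A × A` with `D (x, y) = (∂ y, ∂' x)`. -/
def triple : EvenTriple A (A × A) where
  rep := Algebra.lsmul ℂ ℂ (A × A)
  D := (S.del ∘ₗ LinearMap.snd ℂ _ _).prod (S.del' ∘ₗ LinearMap.fst ℂ _ _)
  γ := (LinearMap.fst ℂ _ _).prod (-LinearMap.snd ℂ _ _)
  γ_sq := LinearMap.ext fun x => by simp
  γ_comm a := LinearMap.ext fun x => by simp
  γ_anti := LinearMap.ext fun x => by simp

theorem rep_apply (x : Doubled A) (y z : A) :
    S.triple.double.rep x (y, z) = (plus x * y, minus x * z) := by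
  change x.fst • (y, z) + ((x.snd • (y, z)).1, -(x.snd • (y, z)).2) = _
  simp [plus_apply, minus_apply, add_mul, sub_eq_add_neg]

/-- The Leibniz rule turns ∂∘m - p∘∂ into ∂m + (m - p)∂. The first-order term disappears only when
the even and odd components agree. -/
theorem comm_apply (x : Doubled A) (y z : A) :
    S.triple.double.comm ((scalars (Doubled A)).mkQ x) (y, z) =
      (S.del (minus x) * z + (minus x - plus x) * S.del z,
        S.del' (plus x) * y + (plus x - minus x) * S.del' y) := by
  rw [EvenTriple.comm_mk]
  have hD : ∀ y z : A, S.triple.double.D (y, z) = (S.del z, S.del' y) := fun _ _ => rfl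
  rw [LinearMap.sub_apply, Module.End.mul_apply, Module.End.mul_apply, rep_apply, hD, hD,
    rep_apply, S.del_mul, S.del'_mul, Prod.mk_sub_mk]
  congr 1 <;> noncomm_ring

/-- The off-diagonal operators with entries `a + b ∂` and `c + e ∂'`. -/
def op₁ : (A × A × A × A) →ₗ[ℂ] Module.End ℂ (A × A) :=
  LinearMap.mk₂ ℂ (fun s x => (s.1 * x.2 + s.2.1 * S.del x.2, s.2.2.1 * x.1 + s.2.2.2 * S.del' x.1))
    (fun s t x => by simp only [Prod.fst_add, Prod.snd_add, add_mul, Prod.mk_add_mk]; congr 1 <;> abel)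
    (fun k s x => by simp)
    (fun s x y => by
      simp only [Prod.fst_add, Prod.snd_add, mul_add, map_add, Prod.mk_add_mk]; congr 1 <;> abel)
    (fun k s x => by simp)

theorem op₁_apply (a b c e y z : A) :
    S.op₁ (a, b, c, e) (y, z) = (a * z + b * S.del z, c * y + e * S.del' y) := rfl

/-- The operators `p + q ∂ + r ∂' + w ∂∂'`. -/
def opHalf : (A × A × A × A) →ₗ[ℂ] Module.End ℂ A :=
  LinearMap.mk₂ ℂ (fun s x => s.1 * x + s.2.1 * S.del x + s.2.2.1 * S.del' x +
      s.2.2.2 * S.del (S.del' x))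
    (fun s t x => by simp only [Prod.fst_add, Prod.snd_add, add_mul]; abel)
    (fun k s x => by simp)
    (fun s x y => by simp only [mul_add, map_add]; abel)
    (fun k s x => by simp)

theorem opHalf_apply (p q r w x : A) :
    S.opHalf (p, q, r, w) x = p * x + q * S.del x + r * S.del' x + w * S.del (S.del' x) := rfl

/-- The diagonal operators with entries `p + q ∂ + r ∂' + w ∂∂'` and
`p' + q' ∂' + r' ∂ + w' ∂'∂`. -/
def op₂ : ((A × A × A × A) × (A × A × A × A)) →ₗ[ℂ] Module.End ℂ (A × A) :=
  LinearMap.mk₂ ℂ (fun s x => (S.opHalf s.1 x.1, S.swap.opHalf s.2 x.2))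
    (fun s t x => by simp) (fun k s x => by simp) (fun s x y => by simp) (fun k s x => by simp)

theorem op₂_apply (s t : A × A × A × A) (y z : A) :
    S.op₂ (s, t) (y, z) = (S.opHalf s y, S.swap.opHalf t z) := rfl

/-- Testing on 1 isolates p. Then u, u⁻¹ and v, with eigenvalue pairs (1, 1), (-1, -1) and (c, -c),
give three linear equations for q, r, w; they are independent because c ≠ 0. -/
theorem opHalf_injective : Function.Injective S.opHalf := by
  rw [← LinearMap.ker_eq_bot, LinearMap.ker_eq_bot']
  rintro ⟨p, q, r, w⟩ h
  have ev : ∀ x, p * x + q * S.del x + r * S.del' x + w * S.del (S.del' x) = 0 := fun x =>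
    LinearMap.congr_fun h x
  have canc : ∀ (z : Aˣ) (x : A), x * z = 0 → x = 0 := fun z x hx => (Units.mul_left_eq_zero z).mp hx
  have hp : p = 0 := by simpa using ev 1
  subst hp
  have h1 : q + r + w = 0 := canc S.u _ (by
    simpa [S.del_u, S.del'_u, add_mul] using ev S.u)
  have h2 : -q - r + w = 0 := canc (S.u⁻¹) _ (by
    have := ev (S.u⁻¹ : Aˣ)
    simp only [S.del_u_inv, S.del'_u_inv, map_neg, neg_neg] at this
    rw [← this]; noncomm_ring)
  have h3 : S.c • q - S.c • r - (S.c * S.c) • w = 0 := canc S.v _ (by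
    have := ev S.v
    simp only [S.del_v, S.del'_v, map_neg, map_smul, smul_smul] at this
    rw [← this]
    simp only [sub_mul, smul_mul_assoc, mul_smul_comm, mul_neg, zero_mul, zero_add]
    abel)
  have hw : w = 0 := by
    have : w = (2⁻¹ : ℂ) • ((q + r + w) + (-q - r + w)) := by module
    rw [this, h1, h2, add_zero, smul_zero]
  subst hw
  have hr : r = -q := by rw [add_zero] at h1; exact (neg_eq_of_add_eq_zero_right h1).symm
  subst hr
  have hq : q = 0 := by
    have h4 : (2 * S.c) • q = 0 := by rw [← h3]; module
    exact (smul_eq_zero.mp h4).resolve_left (mul_ne_zero two_ne_zero S.c_ne_zero)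
  subst hq
  simp

theorem op₂_injective : Function.Injective S.op₂ := by
  rintro ⟨s, t⟩ ⟨s', t'⟩ h
  have h1 : ∀ y z, (S.opHalf s y, S.swap.opHalf t z) = (S.opHalf s' y, S.swap.opHalf t' z) :=
    fun y z => LinearMap.congr_fun h (y, z)
  have h2 : s = s' := S.opHalf_injective (LinearMap.ext fun y => congrArg Prod.fst (h1 y 0))
  have h3 : t = t' := S.swap.opHalf_injective (LinearMap.ext fun z => congrArg Prod.snd (h1 0 z))
  rw [h2, h3]

/-- The two entries are handled separately: 1 detects the order-zero coefficient and the unit u the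
other one. -/
theorem op₁_injective : Function.Injective S.op₁ := by
  have key : ∀ (S : DerivationPair A) (a b : A), (∀ z, a * z + b * S.del z = 0) →
      a = 0 ∧ b = 0 := by
    intro S a b h
    have ha : a = 0 := by simpa using h 1
    have hb := h S.u
    rw [ha, zero_mul, zero_add, S.del_u] at hb
    exact ⟨ha, (Units.mul_left_eq_zero S.u).mp hb⟩
  rw [← LinearMap.ker_eq_bot, LinearMap.ker_eq_bot']
  rintro ⟨a, b, c, e⟩ h
  have h1 : ∀ y z, (a * z + b * S.del z, c * y + e * S.del' y) = (0, 0) :=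
    fun y z => LinearMap.congr_fun h (y, z)
  obtain ⟨rfl, rfl⟩ := key S a b fun z => congrArg Prod.fst (h1 0 z)
  obtain ⟨rfl, rfl⟩ := key S.swap c e fun y => congrArg Prod.snd (h1 y 0)
  rfl

/-! ### Symbols of forms -/

/-- The form `x dy`. -/
def form₁ (x y : Doubled A) : UForms (Doubled A) 1 :=
  x ⊗ₜ PiTensorProduct.tprod ℂ ![(scalars (Doubled A)).mkQ y]

/-- The form `x dy dz`. -/
def form₂ (x y z : Doubled A) : UForms (Doubled A) 2 :=
  x ⊗ₜ PiTensorProduct.tprod ℂ ![(scalars (Doubled A)).mkQ y, (scalars (Doubled A)).mkQ z]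

/-- Scalars are absorbed into the left tensor factor and classes modulo ℂ are lifted, so the forms x
dy generate additively. -/
theorem form₁_induction {p : UForms (Doubled A) 1 → Prop} (zero : p 0)
    (form : ∀ x y, p (form₁ x y)) (add : ∀ ω ω', p ω → p ω' → p (ω + ω')) (ω) : p ω := by
  induction ω using TensorProduct.induction_on with
  | zero => exact zero
  | add ω ω' h h' => exact add _ _ h h'
  | tmul x t =>
    induction t using PiTensorProduct.induction_on with
    | smul_tprod r t =>
      obtain ⟨y, hy⟩ := (scalars (Doubled A)).mkQ_surjective (t 0)
      have ht : t = ![(scalars (Doubled A)).mkQ y] := by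
        funext i; fin_cases i; exact hy.symm
      rw [TensorProduct.tmul_smul, TensorProduct.smul_tmul', ht]
      exact form (r • x) y
    | add t t' h h' => rw [TensorProduct.tmul_add]; exact add _ _ h h'

theorem form₂_induction {p : UForms (Doubled A) 2 → Prop} (zero : p 0)
    (form : ∀ x y z, p (form₂ x y z)) (add : ∀ ω ω', p ω → p ω' → p (ω + ω')) (ω) : p ω := by
  induction ω using TensorProduct.induction_on with
  | zero => exact zero
  | add ω ω' h h' => exact add _ _ h h'
  | tmul x t =>
    induction t using PiTensorProduct.induction_on with
    | smul_tprod r t =>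
      obtain ⟨y, hy⟩ := (scalars (Doubled A)).mkQ_surjective (t 0)
      obtain ⟨z, hz⟩ := (scalars (Doubled A)).mkQ_surjective (t 1)
      have ht : t = ![(scalars (Doubled A)).mkQ y, (scalars (Doubled A)).mkQ z] := by
        funext i; fin_cases i; exacts [hy.symm, hz.symm]
      rw [TensorProduct.tmul_smul, TensorProduct.smul_tmul', ht]
      exact form (r • x) y z
    | add t t' h h' => rw [TensorProduct.tmul_add]; exact add _ _ h h'

theorem ud_form₁ (x y : Doubled A) : ud (Doubled A) 1 (form₁ x y) = form₂ 1 x y := by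
  rw [form₁, ud_tmul_tprod, form₂]
  rfl

theorem repForms_form₁ (x y : Doubled A) :
    S.triple.double.repForms 1 (form₁ x y) =
      S.op₁ (plus x * S.del (minus y), plus x * (minus y - plus y),
        minus x * S.del' (plus y), minus x * (plus y - minus y)) := by
  refine LinearMap.ext fun ⟨s, t⟩ => ?_
  rw [form₁, EvenTriple.repForms_tmul_tprod, op₁_apply]
  simp only [List.ofFn_succ, List.ofFn_zero, List.prod_cons, List.prod_nil, mul_one,
    Module.End.mul_apply, Matrix.cons_val_zero]
  rw [comm_apply, rep_apply]
  simp only [mul_add, mul_assoc]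

/-- The symbol of the upper left entry of the operator of a 2-form with given components. -/
def symbolHalf (x₀ x₁ y₁ x₂ y₂ : A) : A × A × A × A :=
  (x₀ * (S.del y₁ * S.del' x₂ + (y₁ - x₁) * S.del (S.del' x₂)),
    x₀ * ((y₁ - x₁) * S.del' x₂),
    x₀ * (S.del y₁ * (x₂ - y₂) + (y₁ - x₁) * S.del (x₂ - y₂)),
    x₀ * ((y₁ - x₁) * (x₂ - y₂)))

/-- The right-hand side is one diagonal entry of π(x)[D, π(y)][D, π(z)], a composite of two
first-order operators; moving ∂ to the right past the coefficients gives the symbol. -/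
theorem opHalf_symbolHalf (x₀ x₁ y₁ x₂ y₂ x : A) :
    S.opHalf (S.symbolHalf x₀ x₁ y₁ x₂ y₂) x =
      x₀ * (S.del y₁ * (S.del' x₂ * x + (x₂ - y₂) * S.del' x) +
        (y₁ - x₁) * S.del (S.del' x₂ * x + (x₂ - y₂) * S.del' x)) := by
  rw [symbolHalf, opHalf_apply, map_add, S.del_mul, S.del_mul]
  noncomm_ring

theorem repForms_form₂ (x y z : Doubled A) :
    S.triple.double.repForms 2 (form₂ x y z) =
      S.op₂ (S.symbolHalf (plus x) (plus y) (minus y) (plus z) (minus z),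
        S.swap.symbolHalf (minus x) (minus y) (plus y) (minus z) (plus z)) := by
  refine LinearMap.ext fun ⟨s, t⟩ => ?_
  rw [form₂, EvenTriple.repForms_tmul_tprod, op₂_apply, opHalf_symbolHalf, opHalf_symbolHalf]
  simp only [List.ofFn_succ, List.ofFn_zero, List.prod_cons, List.prod_nil, mul_one,
    Module.End.mul_apply, Matrix.cons_val_zero, Matrix.cons_val_succ]
  rw [comm_apply, comm_apply, rep_apply]
  rfl

theorem repForms_one_mem (ω) : S.triple.double.repForms 1 ω ∈ LinearMap.range S.op₁ := by
  induction ω using form₁_induction with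
  | zero => simp
  | form x y => exact ⟨_, (S.repForms_form₁ x y).symm⟩
  | add ω ω' h h' => rw [map_add]; exact add_mem h h'

theorem repForms_two_mem (ω) : S.triple.double.repForms 2 ω ∈ LinearMap.range S.op₂ := by
  induction ω using form₂_induction with
  | zero => simp
  | form x y z => exact ⟨_, (S.repForms_form₂ x y z).symm⟩
  | add ω ω' h h' => rw [map_add]; exact add_mem h h'

/-- The coefficients of the operator of a 1-form. -/
def symbol₁ : UForms (Doubled A) 1 →ₗ[ℂ] A × A × A × A :=
  (LinearEquiv.ofInjective S.op₁ S.op₁_injective).symm.toLinearMap ∘ₗ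
    (S.triple.double.repForms 1).codRestrict _ S.repForms_one_mem

/-- The coefficients of the operator of a 2-form. -/
def symbol₂ : UForms (Doubled A) 2 →ₗ[ℂ] (A × A × A × A) × (A × A × A × A) :=
  (LinearEquiv.ofInjective S.op₂ S.op₂_injective).symm.toLinearMap ∘ₗ
    (S.triple.double.repForms 2).codRestrict _ S.repForms_two_mem

theorem op₁_symbol₁ (ω) : S.op₁ (S.symbol₁ ω) = S.triple.double.repForms 1 ω :=
  congrArg Subtype.val ((LinearEquiv.ofInjective S.op₁ S.op₁_injective).apply_symm_apply _)

theorem op₂_symbol₂ (ω) : S.op₂ (S.symbol₂ ω) = S.triple.double.repForms 2 ω :=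
  congrArg Subtype.val ((LinearEquiv.ofInjective S.op₂ S.op₂_injective).apply_symm_apply _)

theorem symbol₁_form₁ (x y : Doubled A) :
    S.symbol₁ (form₁ x y) = (plus x * S.del (minus y), plus x * (minus y - plus y),
        minus x * S.del' (plus y), minus x * (plus y - minus y)) :=
  S.op₁_injective (by rw [op₁_symbol₁, repForms_form₁])

theorem symbol₂_form₂ (x y z : Doubled A) :
    S.symbol₂ (form₂ x y z) =
      (S.symbolHalf (plus x) (plus y) (minus y) (plus z) (minus z),
        S.swap.symbolHalf (minus x) (minus y) (plus y) (minus z) (plus z)) :=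
  S.op₂_injective (by rw [op₂_symbol₂, repForms_form₂])

theorem mem_J0_one (ω) : ω ∈ S.triple.double.J0 1 ↔ S.symbol₁ ω = 0 := by
  rw [EvenTriple.J0, LinearMap.mem_ker, ← op₁_symbol₁, map_eq_zero_iff _ S.op₁_injective]

theorem mem_J0_two (ω) : ω ∈ S.triple.double.J0 2 ↔ S.symbol₂ ω = 0 := by
  rw [EvenTriple.J0, LinearMap.mem_ker, ← op₂_symbol₂, map_eq_zero_iff _ S.op₂_injective]

/-! ### The junk forms of degree two -/

@[simp] theorem plus_one : plus (1 : Doubled A) = 1 := by simp [plus_apply]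

@[simp] theorem minus_one : minus (1 : Doubled A) = 1 := by simp [minus_apply]

theorem symbol₂_ud_form₁ (x y : Doubled A) :
    S.symbol₂ (ud (Doubled A) 1 (form₁ x y)) =
      (S.symbolHalf 1 (plus x) (minus x) (plus y) (minus y),
        S.swap.symbolHalf 1 (minus x) (plus x) (minus y) (plus y)) := by
  rw [ud_form₁, symbol₂_form₂, plus_one, minus_one]

/-- The symbols of the differentials of the 1-forms represented by zero. -/
def junk : Submodule ℂ ((A × A × A × A) × (A × A × A × A)) :=
  (S.triple.double.J0 1).map (S.symbol₂ ∘ₗ ud (Doubled A) 1)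

theorem mem_junk {s} (ω : UForms (Doubled A) 1) (h : S.symbol₁ ω = 0)
    (h' : S.symbol₂ (ud (Doubled A) 1 ω) = s) : s ∈ S.junk :=
  ⟨ω, (S.mem_J0_one ω).mpr h, h'⟩

/-- With equal components, u and u⁻¹ have commutators of order zero. The two summands are
represented by a and -a in the same entry and cancel. After differentiation the first-order terms
are again opposite, whereas ∂∂'u = u and ∂∂'u⁻¹ = u⁻¹ have the same sign and add up. -/
theorem junk_even_of_order_zero (a : A) : (((-2 : ℂ) • a, 0, 0, 0), 0) ∈ S.junk := by
  refine S.mem_junk (form₁ (pair (a * (S.u⁻¹ : Aˣ)) 0) (pair S.u S.u) +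
    form₁ (pair (a * S.u) 0) (pair (S.u⁻¹ : Aˣ) (S.u⁻¹ : Aˣ))) ?_ ?_
  · rw [map_add, symbol₁_form₁, symbol₁_form₁]
    simp [S.del_u, S.del_u_inv]
  · rw [map_add, map_add, symbol₂_ud_form₁, symbol₂_ud_form₁]
    simp [symbolHalf, S.del_u, S.del_u_inv, S.del'_u, S.del'_u_inv, S.del'_mul, mul_assoc, add_mul]
    module

theorem junk_odd_of_order_zero (a : A) : (0, ((-2 : ℂ) • a, 0, 0, 0)) ∈ S.junk := by
  refine S.mem_junk (form₁ (pair 0 (a * (S.u⁻¹ : Aˣ))) (pair S.u S.u) +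
    form₁ (pair 0 (a * S.u)) (pair (S.u⁻¹ : Aˣ) (S.u⁻¹ : Aˣ))) ?_ ?_
  · rw [map_add, symbol₁_form₁, symbol₁_form₁]
    simp [S.del'_u, S.del'_u_inv]
  · rw [map_add, map_add, symbol₂_ud_form₁, symbol₂_ud_form₁]
    simp [symbolHalf, S.del_u, S.del_u_inv, S.del'_u, S.del'_u_inv, S.del_mul, mul_assoc, add_mul]
    module

/-- Both summands are represented by ∓a∂, so they cancel. In the even entry their differentials give
-a z⁻¹∂∂'z = -a(∂ + e)(∂' + e') and a∂∂', leaving only terms of lower order. In the odd entry z⁻¹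
meets z directly and everything cancels. -/
theorem junk_even_of_eigen (a : A) {z : Aˣ} {e e' : ℂ} (h : S.del z = e • (z : A))
    (h' : S.del' z = e' • (z : A)) :
    ((-(e * e') • a, -e' • a, -e • a, 0), 0) ∈ S.junk := by
  refine S.mem_junk (form₁ (pair (a * (z⁻¹ : Aˣ)) 0) (pair z 0) +
    form₁ (pair a 0) (pair 0 1)) ?_ ?_
  · rw [map_add, symbol₁_form₁, symbol₁_form₁]
    simp
  · rw [map_add, map_add, symbol₂_ud_form₁, symbol₂_ud_form₁]
    have hi := S.swap.del_inv_of_eigen h'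
    simp only [swap_del] at hi
    simp [symbolHalf, h, h', hi, S.del'_mul, mul_assoc, add_mul, smul_smul, mul_comm e e']

theorem junk_odd_of_eigen (a : A) {z : Aˣ} {e e' : ℂ} (h : S.del z = e • (z : A))
    (h' : S.del' z = e' • (z : A)) :
    (0, (-(e * e') • a, -e • a, -e' • a, 0)) ∈ S.junk := by
  refine S.mem_junk (form₁ (pair 0 (a * (z⁻¹ : Aˣ))) (pair 0 z) +
    form₁ (pair 0 a) (pair 1 0)) ?_ ?_
  · rw [map_add, symbol₁_form₁, symbol₁_form₁]
    simp
  · rw [map_add, map_add, symbol₂_ud_form₁, symbol₂_ud_form₁]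
    have hi := S.del_inv_of_eigen h
    simp [symbolHalf, h, h', hi, S.del_mul, mul_assoc, add_mul, smul_smul]

theorem mem_junk_of_principal_eq_zero (p q r p' q' r' : A) :
    ((p, q, r, 0), (p', q', r', 0)) ∈ S.junk := by
  have hc := S.c_ne_zero
  have hu : S.del S.u = (1 : ℂ) • (S.u : A) := by rw [one_smul, S.del_u]
  have hu' : S.del' S.u = (1 : ℂ) • (S.u : A) := by rw [one_smul, S.del'_u]
  have hv' : S.del' S.v = (-S.c) • (S.v : A) := by rw [neg_smul, S.del'_v]
  have key : ∀ p q r : A, ∃ a b g : A,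
      p = (-2 : ℂ) • g + -((1 : ℂ) * 1) • a + -(S.c * -S.c) • b ∧
      q = -(1 : ℂ) • a + -(-S.c) • b ∧ r = -(1 : ℂ) • a + -S.c • b := by
    intro p q r
    -- The eigenvalue pairs (1, 1) of u and (c, -c) of v span the first-order coefficients: solve q
    -- = -a + c b and r = -a - c b, then choose g to correct the order-zero term.
    refine ⟨(-(1 / 2) : ℂ) • (q + r), (1 / (2 * S.c)) • (q - r),
      (1 / 2 : ℂ) • ((1 / 2 : ℂ) • (q + r) + (S.c / 2) • (q - r) - p), ?_, ?_, ?_⟩ <;>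
    match_scalars <;> field_simp <;> ring
  have h1 : ((p, q, r, 0), 0) ∈ S.junk := by
    obtain ⟨a, b, g, rfl, rfl, rfl⟩ := key p q r
    simpa using add_mem (add_mem (S.junk_even_of_order_zero g) (S.junk_even_of_eigen a hu hu'))
      (S.junk_even_of_eigen b S.del_v hv')
  have h2 : (0, (p', q', r', 0)) ∈ S.junk := by
    -- In the odd half the derivations exchange roles, hence the swapped first-order coefficients.
    obtain ⟨a, b, g, rfl, rfl, rfl⟩ := key p' r' q'
    simpa using add_mem (add_mem (S.junk_odd_of_order_zero g) (S.junk_odd_of_eigen a hu hu'))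
      (S.junk_odd_of_eigen b S.del_v hv')
  simpa using add_mem h1 h2

/-! ### Connes' forms -/

/-- The coefficients of the second order terms of the operator of a 2-form. -/
def principal : UForms (Doubled A) 2 →ₗ[ℂ] A × A :=
  LinearMap.prod
    (LinearMap.snd ℂ A A ∘ₗ LinearMap.snd ℂ A _ ∘ₗ LinearMap.snd ℂ A _ ∘ₗ
      LinearMap.fst ℂ (A × A × A × A) (A × A × A × A))
    (LinearMap.snd ℂ A A ∘ₗ LinearMap.snd ℂ A _ ∘ₗ LinearMap.snd ℂ A _ ∘ₗ
      LinearMap.snd ℂ (A × A × A × A) (A × A × A × A)) ∘ₗ S.symbol₂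

theorem principal_apply (ω) : S.principal ω = ((S.symbol₂ ω).1.2.2.2, (S.symbol₂ ω).2.2.2.2) := rfl

/-- On x dy, with components p and m, both leading coefficients of dx dy equal (m(x) - p(x))(p(y) -
m(y)), and this is also the sum of the two first-order coefficients of x dy. -/
theorem principal_ud (ω) : S.principal (ud (Doubled A) 1 ω) =
    ((S.symbol₁ ω).2.1 + (S.symbol₁ ω).2.2.2, (S.symbol₁ ω).2.1 + (S.symbol₁ ω).2.2.2) := by
  induction ω using form₁_induction with
  | zero => simp; rfl
  | form x y =>
    rw [principal_apply, symbol₂_ud_form₁, symbol₁_form₁]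
    simp only [symbolHalf]
    congr 1 <;> noncomm_ring
  | add ω ω' h h' =>
    simp only [map_add, h, h', Prod.mk_add_mk, Prod.fst_add, Prod.snd_add]
    congr 1 <;> abel

theorem symbol₁_surjective : Function.Surjective S.symbol₁ := by
  rintro ⟨a, b, c, e⟩
  -- The differential of (u, u) has only order-zero terms and supplies a and c. That of (0, 1) is
  -- purely first-order, with coefficients of opposite sign, hence the -e.
  refine ⟨form₁ (pair (a * (S.u⁻¹ : Aˣ)) (c * (S.u⁻¹ : Aˣ))) (pair S.u S.u) +
    form₁ (pair b (-e)) (pair 0 1), ?_⟩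
  rw [map_add, symbol₁_form₁, symbol₁_form₁]
  simp [S.del_u, S.del'_u]

theorem principal_surjective : Function.Surjective S.principal := by
  rintro ⟨w, w'⟩
  refine ⟨form₂ (pair (-w) (-w')) (pair 1 0) (pair 1 0), ?_⟩
  rw [principal_apply, symbol₂_form₂]
  simp [symbolHalf]

/-- Forms of degree zero are elements of the algebra. -/
def formsZero : (Doubled A) ≃ₗ[ℂ] UForms (Doubled A) 0 :=
  (TensorProduct.rid ℂ (Doubled A)).symm ≪≫ₗ
    TensorProduct.congr (LinearEquiv.refl ℂ _) (PiTensorProduct.isEmptyEquiv (Fin 0)).symm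

theorem formsZero_apply (x : Doubled A) (t : Fin 0 → Abar (Doubled A)) :
    formsZero x = x ⊗ₜ PiTensorProduct.tprod ℂ t := by
  simp [formsZero]
  rw [Subsingleton.elim t isEmptyElim]

theorem repForms_formsZero (x : Doubled A) (y z : A) :
    S.triple.double.repForms 0 (formsZero x) (y, z) = (plus x * y, minus x * z) := by
  rw [formsZero_apply x (fun _ => 0), EvenTriple.repForms_tmul_tprod]
  simp [rep_apply]

theorem ud_formsZero (x : Doubled A) : ud (Doubled A) 0 (formsZero x) = form₁ 1 x := by
  rw [formsZero_apply x (fun _ => 0), ud_tmul_tprod, form₁]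
  congr 2
  funext i
  fin_cases i
  rfl

/-- The even and odd components as a linear isomorphism. -/
def components : Doubled A ≃ₗ[ℂ] A × A where
  __ := plus.prod minus
  invFun s := pair s.1 s.2
  left_inv x := pair_plus_minus x
  right_inv s := by simp

theorem components_apply (x : Doubled A) : components x = (plus x, minus x) := rfl

/-- Acting on the vector (1, 1) recovers both components. -/
theorem J_zero : S.triple.double.J 0 = ⊥ := by
  change LinearMap.ker (S.triple.double.repForms 0) = ⊥
  rw [LinearMap.ker_eq_bot']
  intro ω h
  obtain ⟨x, rfl⟩ := formsZero.surjective ω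
  have h1 := S.repForms_formsZero x 1 1
  rw [h, mul_one, mul_one, LinearMap.zero_apply] at h1
  obtain ⟨hp, hm⟩ := Prod.mk.inj h1
  rw [← pair_plus_minus x, ← hp, ← hm]
  have : pair (0 : A) 0 = 0 := by ext <;> simp [pair]
  simp [this]

theorem J_one : S.triple.double.J 1 = LinearMap.ker S.symbol₁ := by
  change S.triple.double.J0 1 ⊔ (S.triple.double.J 0).map (ud (Doubled A) 0) = _
  rw [J_zero, Submodule.map_bot, sup_bot_eq]
  ext ω
  rw [mem_J0_one, LinearMap.mem_ker]

theorem J_two : S.triple.double.J 2 = LinearMap.ker S.principal := by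
  refine le_antisymm (sup_le ?_ ?_) ?_
  · intro ω h
    rw [LinearMap.mem_ker, principal_apply, (S.mem_J0_two ω).mp h]
    rfl
  · rintro _ ⟨ω, h, rfl⟩
    rw [LinearMap.mem_ker, principal_ud, (S.mem_J0_one ω).mp h]
    simp
  · intro ω h
    rw [LinearMap.mem_ker, principal_apply] at h
    rcases hs : S.symbol₂ ω with ⟨⟨p, q, r, w⟩, p', q', r', w'⟩
    rw [hs] at h
    obtain ⟨rfl, rfl⟩ : w = 0 ∧ w' = 0 := by simpa using h
    obtain ⟨η, hη, hη'⟩ := S.mem_junk_of_principal_eq_zero p q r p' q' r'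
    -- Subtracting the differential of a 1-form represented by zero removes all lower-order terms,
    -- and what remains is represented by zero.
    refine Submodule.mem_sup.mpr ⟨ω - ud (Doubled A) 1 η, ?_, _, ⟨η, hη, rfl⟩, sub_add_cancel _ _⟩
    rw [mem_J0_two, map_sub, hs, ← hη', LinearMap.comp_apply, sub_self]

/-- `Ω_D⁰ ≃ A²`. -/
def forms₀ : S.triple.double.Forms 0 ≃ₗ[ℂ] A × A :=
  Submodule.quotEquivOfEqBot _ S.J_zero ≪≫ₗ formsZero.symm ≪≫ₗ components

/-- `Ω_D¹ ≃ A⁴`. -/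
def forms₁ : S.triple.double.Forms 1 ≃ₗ[ℂ] A × A × A × A :=
  Submodule.quotEquivOfEq _ _ S.J_one ≪≫ₗ S.symbol₁.quotKerEquivOfSurjective S.symbol₁_surjective

/-- `Ω_D² ≃ A²`. -/
def forms₂ : S.triple.double.Forms 2 ≃ₗ[ℂ] A × A :=
  Submodule.quotEquivOfEq _ _ S.J_two ≪≫ₗ
    S.principal.quotKerEquivOfSurjective S.principal_surjective

theorem forms₀_mk (x : Doubled A) :
    S.forms₀ (Submodule.Quotient.mk (formsZero x)) = (plus x, minus x) := by
  rw [← components_apply]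
  simp [forms₀]

theorem forms₁_mk (ω) : S.forms₁ (Submodule.Quotient.mk ω) = S.symbol₁ ω := rfl

theorem forms₂_mk (ω) : S.forms₂ (Submodule.Quotient.mk ω) = S.principal ω := rfl

theorem repForms_zero_of_forms₀ (ω) (a b : A) (h : S.forms₀ (Submodule.Quotient.mk ω) = (a, b))
    (x y : A) : S.triple.double.repForms 0 ω (x, y) = (a * x, b * y) := by
  obtain ⟨z, rfl⟩ := formsZero.surjective ω
  rw [forms₀_mk, Prod.mk.injEq] at h
  rw [repForms_formsZero, h.1, h.2]

theorem repForms_one_of_forms₁ (ω) (a b c e : A)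
    (h : S.forms₁ (Submodule.Quotient.mk ω) = (a, b, c, e)) (x y : A) :
    S.triple.double.repForms 1 ω (x, y) = (a * y + b * S.del y, c * x + e * S.del' x) := by
  rw [← op₁_symbol₁, ← forms₁_mk, h, op₁_apply]

theorem repForms_two_of_forms₂ (ω) (w w' : A)
    (h : S.forms₂ (Submodule.Quotient.mk ω) = (w, w')) :
    ∃ p q r p' q' r' : A, ∀ x y : A, S.triple.double.repForms 2 ω (x, y) =
      (p * x + q * S.del x + r * S.del' x + w * S.del (S.del' x),
        p' * y + q' * S.del' y + r' * S.del y + w' * S.del' (S.del y)) := by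
  rw [forms₂_mk, principal_apply] at h
  obtain ⟨rfl, rfl⟩ := Prod.mk.inj h
  exact ⟨_, _, _, _, _, _, fun x y => by rw [← op₂_symbol₂]; rfl⟩

theorem forms₁_d (η) (a b : A) (h : S.forms₀ η = (a, b)) :
    S.forms₁ (S.triple.double.d 0 η) = (S.del b, b - a, S.del' a, a - b) := by
  obtain ⟨ω, rfl⟩ := Submodule.Quotient.mk_surjective _ η
  obtain ⟨x, rfl⟩ := formsZero.surjective ω
  rw [forms₀_mk, Prod.mk.injEq] at h
  change S.forms₁ (Submodule.Quotient.mk (ud (Doubled A) 0 (formsZero x))) = _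
  rw [ud_formsZero, forms₁_mk, symbol₁_form₁, h.1, h.2]
  simp

theorem forms₂_d (η) (a b c e : A) (h : S.forms₁ η = (a, b, c, e)) :
    S.forms₂ (S.triple.double.d 1 η) = (b + e, b + e) := by
  obtain ⟨ω, rfl⟩ := Submodule.Quotient.mk_surjective _ η
  rw [forms₁_mk] at h
  change S.forms₂ (Submodule.Quotient.mk (ud (Doubled A) 1 ω)) = _
  rw [forms₂_mk, principal_ud, h]

end DerivationPair

end Connes

/-! ### Fourier coefficients on the smooth torus and the derivations d and d* -/

namespace NCTorus

variable {θ : ℝ}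

/-- The coefficient of `U^{r₁} V^{r₂}` in a smooth element. -/
def coef (r : ℤ × ℤ) : Smooth θ →ₗ[ℂ] ℂ :=
  LinearMap.proj r ∘ₗ Schwartz.subtype ∘ₗ (smoothEquiv θ).symm.toLinearMap

theorem coef_smoothEquiv (a : Schwartz) (r : ℤ × ℤ) : coef r (smoothEquiv θ a) = a.1 r := by
  change ((smoothEquiv θ).symm (smoothEquiv θ a)).1 r = _
  rw [LinearEquiv.symm_apply_apply]

theorem smooth_ext {x y : Smooth θ} (h : ∀ r, coef r x = coef r y) : x = y :=
  (smoothEquiv θ).symm.injective (Subtype.ext (funext h))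

theorem smoothEquiv_mul (a b : Schwartz) :
    smoothEquiv θ a * smoothEquiv θ b = smoothEquiv θ (conv θ a b) :=
  Subtype.ext (sumW_mul_sumW θ a b)

/-- `r₁ - i r₂`. -/
def freq : ℤ × ℤ →+ ℂ where
  toFun r := r.1 - Complex.I * r.2
  map_zero' := by simp
  map_add' r s := by simp; ring

/-- `r₁ + i r₂`. -/
def freqStar : ℤ × ℤ →+ ℂ where
  toFun r := r.1 + Complex.I * r.2
  map_zero' := by simp
  map_add' r s := by simp; ring

theorem freq_apply (r : ℤ × ℤ) : freq r = r.1 - Complex.I * r.2 := rfl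

theorem freqStar_apply (r : ℤ × ℤ) : freqStar r = r.1 + Complex.I * r.2 := rfl

theorem normSq_freq (r : ℤ × ℤ) : Complex.normSq (freq r) = ((r.1 * r.1 + r.2 * r.2 : ℤ) : ℝ) := by
  simp [freq_apply, Complex.normSq_apply]

theorem normSq_freqStar (r : ℤ × ℤ) :
    Complex.normSq (freqStar r) = ((r.1 * r.1 + r.2 * r.2 : ℤ) : ℝ) := by
  simp [freqStar_apply, Complex.normSq_apply]

/-- The squared modulus is the integer r₁² + r₂², positive off the origin. There are therefore no
small divisors, and dividing coefficients preserves rapid decay for every θ. -/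
theorem one_le_norm_of_normSq {r : ℤ × ℤ} (hr : r ≠ 0) {z : ℂ}
    (hz : Complex.normSq z = ((r.1 * r.1 + r.2 * r.2 : ℤ) : ℝ)) : 1 ≤ ‖z‖ := by
  have h1 : 1 ≤ r.1 * r.1 + r.2 * r.2 := by
    by_contra! h
    have h1 : r.1 = 0 := by nlinarith
    have h2 : r.2 = 0 := by nlinarith
    exact hr (Prod.ext h1 h2)
  have h2 : (1 : ℝ) ≤ ‖z‖ ^ 2 := by
    rw [← Complex.normSq_eq_norm_sq, hz]
    exact_mod_cast h1
  exact (one_le_sq_iff₀ (norm_nonneg z)).mp h2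

theorem one_le_norm_freq {r : ℤ × ℤ} (hr : r ≠ 0) : 1 ≤ ‖freq r‖ :=
  one_le_norm_of_normSq hr (normSq_freq r)

theorem one_le_norm_freqStar {r : ℤ × ℤ} (hr : r ≠ 0) : 1 ≤ ‖freqStar r‖ :=
  one_le_norm_of_normSq hr (normSq_freqStar r)

theorem coef_δ₁ (x : Smooth θ) (r : ℤ × ℤ) : coef r (δ₁ θ x) = r.1 * coef r x :=
  coef_smoothEquiv _ r

theorem coef_δ₂ (x : Smooth θ) (r : ℤ × ℤ) : coef r (δ₂ θ x) = r.2 * coef r x :=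
  coef_smoothEquiv _ r

theorem coef_dd (x : Smooth θ) (r : ℤ × ℤ) : coef r (dd θ x) = freq r * coef r x := by
  rw [dd, LinearMap.sub_apply, LinearMap.smul_apply, map_sub, map_smul, coef_δ₁, coef_δ₂,
    freq_apply, smul_eq_mul]
  ring

theorem coef_ddStar (x : Smooth θ) (r : ℤ × ℤ) :
    coef r (ddStar θ x) = freqStar r * coef r x := by
  rw [ddStar, LinearMap.add_apply, LinearMap.smul_apply, map_add, map_smul, coef_δ₁, coef_δ₂,
    freqStar_apply, smul_eq_mul]
  ring

theorem coef_mul (x y : Smooth θ) (n : ℤ × ℤ) :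
    HasSum (fun r => phase θ ^ (-(r.2 * (n - r).1)) * (coef r x * coef (n - r) y))
      (coef n (x * y)) := by
  obtain ⟨a, rfl⟩ := (smoothEquiv θ).surjective x
  obtain ⟨b, rfl⟩ := (smoothEquiv θ).surjective y
  simp only [smoothEquiv_mul, coef_smoothEquiv]
  exact (summable_convFun θ a b n).of_norm.hasSum

/-- An operator multiplying the coefficients by an additive weight is a derivation. -/
theorem leibniz_of_coef (D : Smooth θ →ₗ[ℂ] Smooth θ) (w : ℤ × ℤ →+ ℂ)
    (hD : ∀ x r, coef r (D x) = w r * coef r x) (x y : Smooth θ) :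
    D (x * y) = D x * y + x * D y := by
  refine smooth_ext fun n => ?_
  rw [hD, map_add]
  refine ((coef_mul x y n).mul_left (w n)).unique ?_
  refine ((coef_mul (D x) y n).add (coef_mul x (D y) n)).congr_fun fun r => ?_
  have h : w n = w r + w (n - r) := by rw [← map_add, add_sub_cancel]
  rw [hD, hD, h]
  ring

theorem dd_mul (x y : Smooth θ) : dd θ (x * y) = dd θ x * y + x * dd θ y :=
  leibniz_of_coef (dd θ) freq coef_dd x y

theorem ddStar_mul (x y : Smooth θ) : ddStar θ (x * y) = ddStar θ x * y + x * ddStar θ y :=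
  leibniz_of_coef (ddStar θ) freqStar coef_ddStar x y

/-! ### Monomials -/

/-- The sequence with the value `1` at `r` and zero elsewhere. -/
def singleS (r : ℤ × ℤ) : Schwartz :=
  ⟨Pi.single r 1, fun k => ⟨wt r ^ k, fun s => by
    by_cases h : s = r
    · subst h
      simp
    · simpa [Pi.single_eq_of_ne h] using pow_nonneg (wt_pos r).le k⟩⟩

/-- The smooth element `U^{r₁} V^{r₂}`. -/
def mono (θ : ℝ) (r : ℤ × ℤ) : Smooth θ := smoothEquiv θ (singleS r)

theorem coe_mono (r : ℤ × ℤ) : (mono θ r : Torus θ) = W θ r := by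
  rw [mono, coe_smoothEquiv, tsum_eq_single r fun s h => by simp [singleS, Pi.single_eq_of_ne h]]
  simp [singleS]

theorem coef_mono (r s : ℤ × ℤ) : coef s (mono θ r) = if s = r then 1 else 0 := by
  rw [mono, coef_smoothEquiv, ← Pi.single_apply]
  rfl

theorem mono_zero : mono θ 0 = 1 := by
  refine Subtype.ext ?_
  rw [coe_mono]
  simp [W]

theorem coef_one (s : ℤ × ℤ) : coef s (1 : Smooth θ) = if s = 0 then 1 else 0 := by
  rw [← mono_zero, coef_mono]

theorem mono_mul_mono (r s : ℤ × ℤ) :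
    mono θ r * mono θ s = phase θ ^ (-(r.2 * s.1)) • mono θ (r + s) := by
  refine Subtype.ext ?_
  change (mono θ r : Torus θ) * mono θ s = phase θ ^ (-(r.2 * s.1)) • (mono θ (r + s) : Torus θ)
  rw [coe_mono, coe_mono, coe_mono, W_mul_W]

/-- A monomial as a unit. -/
def monoUnit (θ : ℝ) (r : ℤ × ℤ) (hr : r.2 * r.1 = 0) : (Smooth θ)ˣ where
  val := mono θ r
  inv := mono θ (-r)
  -- Multiplying the monomials of r and -r produces the phase to the power r₂r₁, which `hr` makes
  -- trivial.
  val_inv := by rw [mono_mul_mono]; simp [hr, mono_zero]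
  inv_val := by rw [mono_mul_mono]; simp [hr, mono_zero]

theorem dd_mono (r : ℤ × ℤ) : dd θ (mono θ r) = freq r • mono θ r := by
  refine smooth_ext fun s => ?_
  rw [coef_dd, map_smul, coef_mono, smul_eq_mul]
  split_ifs with h
  · rw [h]
  · simp

theorem ddStar_mono (r : ℤ × ℤ) : ddStar θ (mono θ r) = freqStar r • mono θ r := by
  refine smooth_ext fun s => ?_
  rw [coef_ddStar, map_smul, coef_mono, smul_eq_mul]
  split_ifs with h
  · rw [h]
  · simp

/-- The derivations `d` and `d*` of the smooth noncommutative torus. -/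
def derivationPair (θ : ℝ) : Connes.DerivationPair (Smooth θ) where
  del := dd θ
  del' := ddStar θ
  del_mul := dd_mul
  del'_mul := ddStar_mul
  u := monoUnit θ (1, 0) (by simp)
  v := monoUnit θ (0, 1) (by simp)
  -- The frequencies of V are r₁ ∓ i r₂ at (0, 1), that is -i and i.
  c := -Complex.I
  c_ne_zero := neg_ne_zero.mpr Complex.I_ne_zero
  del_u := (dd_mono _).trans (by simp [freq_apply, monoUnit])
  del'_u := (ddStar_mono _).trans (by simp [freqStar_apply, monoUnit])
  del_v := (dd_mono _).trans (by simp [freq_apply, monoUnit])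
  del'_v := (ddStar_mono _).trans (by simp [freqStar_apply, monoUnit])

theorem doubledTriple_eq (θ : ℝ) : doubledTriple θ = (derivationPair θ).triple.double := rfl

/-! ### The cohomology of the complex of coefficients -/

theorem mem_scalars_iff (x : Smooth θ) :
    x ∈ Connes.scalars (Smooth θ) ↔ ∀ r, r ≠ 0 → coef r x = 0 := by
  rw [Connes.scalars, Submodule.mem_span_singleton]
  constructor
  · rintro ⟨k, rfl⟩ r hr
    rw [map_smul, coef_one, if_neg hr, smul_zero]
  · intro h
    refine ⟨coef 0 x, smooth_ext fun r => ?_⟩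
    rw [map_smul, coef_one]
    split_ifs with hr
    · rw [hr, smul_eq_mul, mul_one]
    · rw [h r hr, smul_zero]

/-- Division of the coefficients by a weight bounded below away from the origin. -/
theorem exists_coef_eq_div (w : ℤ × ℤ → ℂ) (hw : ∀ r, r ≠ 0 → 1 ≤ ‖w r‖) (x : Smooth θ) :
    ∃ y : Smooth θ, ∀ r, r ≠ 0 → w r * coef r y = coef r x := by
  -- The value at the origin is arbitrary, since nothing is claimed there.
  have h : ∀ r, ‖if r = 0 then 0 else (w r)⁻¹‖ ≤ wt r := by
    intro r
    split_ifs with hr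
    · simpa using (wt_pos r).le
    · rw [norm_inv]
      exact (inv_le_one_of_one_le₀ (hw r hr)).trans (one_le_wt r)
  refine ⟨smoothEquiv θ (mulWeight _ h ((smoothEquiv θ).symm x)), fun r hr => ?_⟩
  have hne : w r ≠ 0 := norm_pos_iff.mp (zero_lt_one.trans_le (hw r hr))
  rw [coef_smoothEquiv]
  change w r * ((if r = 0 then 0 else (w r)⁻¹) * coef r x) = _
  rw [if_neg hr, mul_inv_cancel_left₀ hne]

theorem exists_dd_eq (x : Smooth θ) (hx : coef 0 x = 0) : ∃ y, dd θ y = x := by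
  obtain ⟨y, hy⟩ := exists_coef_eq_div freq (fun _ => one_le_norm_freq) x
  refine ⟨y, smooth_ext fun r => ?_⟩
  rw [coef_dd]
  by_cases hr : r = 0
  · rw [hr, map_zero, zero_mul, hx]
  · exact hy r hr

theorem exists_ddStar_eq (x : Smooth θ) : ∃ y, coef 0 y = 0 ∧ ∀ r, r ≠ 0 →
    coef r (ddStar θ y) = coef r x := by
  obtain ⟨y, hy⟩ := exists_coef_eq_div freqStar (fun _ => one_le_norm_freqStar) x
  -- Removing the mean affects no other coefficient. It lets `exists_classMap_eq` prescribe the mean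
  -- independently.
  refine ⟨y - coef 0 y • 1, by simp [coef_one], fun r hr => ?_⟩
  rw [coef_ddStar, map_sub, map_smul, coef_one, if_neg hr, smul_zero, sub_zero, hy r hr]

theorem dd_eq_zero {x : Smooth θ} (h : dd θ x = 0) : x = coef 0 x • 1 := by
  refine smooth_ext fun r => ?_
  rw [map_smul, coef_one]
  split_ifs with hr
  · rw [hr, smul_eq_mul, mul_one]
  · have h1 := coef_dd x r
    rw [h, map_zero] at h1
    have hne : freq r ≠ 0 := norm_pos_iff.mp (zero_lt_one.trans_le (one_le_norm_freq hr))
    rw [smul_zero, (mul_eq_zero.mp h1.symm).resolve_left hne]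

/-- The obstruction `(∫ (a - d b), ∫ c, d* (a - d b) - d c)` to exactness of `(a, b, c, -b)`. -/
def classMap (θ : ℝ) : Smooth θ × Smooth θ × Smooth θ × Smooth θ →ₗ[ℂ]
    ℂ × ℂ × (Smooth θ ⧸ Connes.scalars (Smooth θ)) where
  toFun s := (coef 0 (s.1 - dd θ s.2.1), coef 0 s.2.2.1,
    (Connes.scalars (Smooth θ)).mkQ (ddStar θ (s.1 - dd θ s.2.1) - dd θ s.2.2.1))
  map_add' s t := by
    simp only [Prod.fst_add, Prod.snd_add, map_add, map_sub, Prod.mk_add_mk, Prod.mk.injEq]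
    refine ⟨by abel, trivial, by abel⟩
  map_smul' k s := by
    simp only [Prod.smul_fst, Prod.smul_snd, map_smul, map_sub, RingHom.id_apply, Prod.smul_mk,
      smul_sub]

theorem classMap_apply (a b c e : Smooth θ) : classMap θ (a, b, c, e) =
    (coef 0 (a - dd θ b), coef 0 c,
      (Connes.scalars (Smooth θ)).mkQ (ddStar θ (a - dd θ b) - dd θ c)) := rfl

theorem ddStar_dd (x : Smooth θ) : ddStar θ (dd θ x) = dd θ (ddStar θ x) := by
  refine smooth_ext fun r => ?_
  simp only [coef_dd, coef_ddStar]
  ring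

theorem classMap_coboundary (a b : Smooth θ) :
    classMap θ (dd θ b, b - a, ddStar θ a, a - b) = 0 := by
  have h : dd θ b - dd θ (b - a) = dd θ a := by rw [map_sub, sub_sub_cancel]
  rw [classMap_apply, h, ddStar_dd, sub_self, map_zero, coef_dd, coef_ddStar, map_zero, map_zero,
    zero_mul]
  rfl

theorem exists_of_classMap_eq_zero (a b c : Smooth θ) (h : classMap θ (a, b, c, -b) = 0) :
    ∃ a' b', (dd θ b', b' - a', ddStar θ a', a' - b') = (a, b, c, -b) := by
  rw [classMap_apply, Prod.mk_eq_zero, Prod.mk_eq_zero] at h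
  obtain ⟨hx, hc, hm⟩ := h
  rw [Submodule.mkQ_apply, Submodule.Quotient.mk_eq_zero, mem_scalars_iff] at hm
  obtain ⟨a', ha'⟩ := exists_dd_eq _ hx
  -- Vanishing modulo scalars becomes true vanishing, because elements in the ranges of d and d*
  -- have zero coefficient at the origin.
  have h0 : dd θ (ddStar θ a' - c) = 0 := by
    rw [map_sub, ← ddStar_dd, ha']
    refine smooth_ext fun r => ?_
    rw [map_zero]
    by_cases hr : r = 0
    · rw [hr, map_sub, coef_dd, coef_ddStar, map_zero, map_zero, zero_mul, zero_mul, sub_zero]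
    · exact hm r hr
  -- The difference is a constant, and both terms have mean zero.
  have h1 : ddStar θ a' = c := by
    rw [← sub_eq_zero, dd_eq_zero h0, map_sub, hc, coef_ddStar, map_zero, zero_mul, sub_zero,
      zero_smul]
  refine ⟨a', b + a', ?_⟩
  rw [h1, map_add, ha']
  simp

theorem exists_classMap_eq (t) : ∃ a c : Smooth θ, classMap θ (a, 0, c, 0) = t := by
  obtain ⟨s, t, q⟩ := t
  obtain ⟨z, rfl⟩ := Submodule.mkQ_surjective _ q
  obtain ⟨y, hy, hy'⟩ := exists_ddStar_eq z
  -- The constants s and t set the two means and are killed by d and d*, so they leave the third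
  -- component to y alone.
  refine ⟨y + s • 1, t • 1, ?_⟩
  rw [classMap_apply, map_zero, sub_zero]
  refine Prod.ext ?_ (Prod.ext ?_ ?_)
  · simp [hy, coef_one]
  · simp [coef_one]
  · change (Connes.scalars (Smooth θ)).mkQ _ = (Connes.scalars (Smooth θ)).mkQ z
    rw [← sub_eq_zero, ← map_sub, Submodule.mkQ_apply, Submodule.Quotient.mk_eq_zero,
      mem_scalars_iff]
    intro r hr
    rw [map_sub, map_sub, map_add, map_add, hy' r hr, map_smul, map_smul, map_smul, map_smul,
      coef_ddStar, coef_dd, coef_one, if_neg hr]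
    simp

/-! ### The cohomology of Connes' complex -/

/-- A linear map on cocycles which is surjective with kernel the coboundaries computes the
cohomology. -/
def cohomologyEquiv {A V X : Type*} [Ring A] [Algebra ℂ A] [AddCommGroup V] [Module ℂ V]
    [AddCommGroup X] [Module ℂ X] (T : Connes.EvenTriple A V) (k : ℕ)
    (f : LinearMap.ker (T.d k) →ₗ[ℂ] X) (hf : Function.Surjective f)
    (hk : ∀ η, f η = 0 ↔ (η : T.Forms k) ∈ T.coboundaries k) : T.Cohomology k ≃ₗ[ℂ] X :=
  Submodule.quotEquivOfEq _ _ (by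
    ext η
    rw [LinearMap.mem_ker, hk]
    rfl) ≪≫ₗ f.quotKerEquivOfSurjective hf

/-- A cocycle (a, b) has a = b and db = 0, so it is a common constant, read off as a mean. -/
theorem nonempty_cohomology_zero (θ : ℝ) :
    Nonempty ((doubledTriple θ).Cohomology 0 ≃ₗ[ℂ] ℂ) := by
  rw [doubledTriple_eq]
  set S := derivationPair θ
  let f : LinearMap.ker (S.triple.double.d 0) →ₗ[ℂ] ℂ :=
    coef 0 ∘ₗ LinearMap.fst ℂ _ _ ∘ₗ S.forms₀.toLinearMap ∘ₗ Submodule.subtype _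
  refine ⟨cohomologyEquiv _ 0 f ?_ ?_⟩
  · intro s
    refine ⟨⟨S.forms₀.symm (s • 1, s • 1), ?_⟩, ?_⟩
    · rw [LinearMap.mem_ker]
      refine S.forms₁.injective ?_
      rw [S.forms₁_d _ _ _ (S.forms₀.apply_symm_apply _)]
      simp
    · change coef 0 (S.forms₀ (S.forms₀.symm (s • 1, s • 1))).1 = s
      rw [LinearEquiv.apply_symm_apply]
      simp [coef_one]
  · rintro ⟨η, hη⟩
    change coef 0 (S.forms₀ η).1 = 0 ↔ η ∈ (⊥ : Submodule ℂ _)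
    rw [Submodule.mem_bot]
    constructor
    · intro h
      rcases he : S.forms₀ η with ⟨a, b⟩
      rw [he] at h
      have h1 := S.forms₁_d η a b he
      rw [LinearMap.mem_ker.mp hη, map_zero] at h1
      obtain ⟨hb, hab, -, -⟩ := by simpa only [Prod.ext_iff] using h1
      have hab' : b = a := sub_eq_zero.mp hab.symm
      have hb' : b = coef 0 b • 1 := dd_eq_zero hb.symm
      have h0 : b = 0 := by rw [hb', hab', h, zero_smul]
      refine S.forms₀.injective ?_
      rw [he, map_zero, ← hab', h0]
      rfl
    · rintro rfl
      simp

theorem nonempty_cohomology_one (θ : ℝ) :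
    Nonempty ((doubledTriple θ).Cohomology 1 ≃ₗ[ℂ]
      ℂ × ℂ × (Smooth θ ⧸ Connes.scalars (Smooth θ))) := by
  rw [doubledTriple_eq]
  set S := derivationPair θ
  refine ⟨cohomologyEquiv _ 1 (classMap θ ∘ₗ S.forms₁.toLinearMap ∘ₗ Submodule.subtype _) ?_ ?_⟩
  · intro t
    obtain ⟨a, c, h⟩ := exists_classMap_eq t
    refine ⟨⟨S.forms₁.symm (a, 0, c, 0), ?_⟩, ?_⟩
    · rw [LinearMap.mem_ker]
      refine S.forms₂.injective ?_
      rw [S.forms₂_d _ _ _ _ _ (S.forms₁.apply_symm_apply _), add_zero, map_zero]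
      rfl
    · change classMap θ (S.forms₁ (S.forms₁.symm (a, 0, c, 0))) = t
      rw [LinearEquiv.apply_symm_apply, h]
  · rintro ⟨η, hη⟩
    change classMap θ (S.forms₁ η) = 0 ↔ η ∈ LinearMap.range (S.triple.double.d 0)
    constructor
    · intro h
      rcases he : S.forms₁ η with ⟨a, b, c, e⟩
      have h1 := S.forms₂_d η a b c e he
      rw [LinearMap.mem_ker.mp hη, map_zero] at h1
      -- The cocycle condition is b + e = 0, so the cocycle has the shape to which the obstruction
      -- criterion applies.
      obtain rfl : e = -b := (neg_eq_of_add_eq_zero_right (congrArg Prod.fst h1).symm).symm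
      rw [he] at h
      obtain ⟨a', b', h2⟩ := exists_of_classMap_eq_zero a b c h
      refine ⟨S.forms₀.symm (a', b'), S.forms₁.injective ?_⟩
      rw [S.forms₁_d _ _ _ (S.forms₀.apply_symm_apply _), he]
      exact h2
    · rintro ⟨ζ, rfl⟩
      rw [S.forms₁_d ζ (S.forms₀ ζ).1 (S.forms₀ ζ).2 rfl]
      exact classMap_coboundary _ _

end NCTorus

end

theorem mainTheorem8 (θ : ℝ) :
    (∃ (Φ₀ : (NCTorus.doubledTriple θ).Forms 0 ≃ₗ[ℂ] NCTorus.Smooth θ × NCTorus.Smooth θ)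
        (Φ₁ : (NCTorus.doubledTriple θ).Forms 1 ≃ₗ[ℂ]
          NCTorus.Smooth θ × NCTorus.Smooth θ × NCTorus.Smooth θ × NCTorus.Smooth θ)
        (Φ₂ : (NCTorus.doubledTriple θ).Forms 2 ≃ₗ[ℂ] NCTorus.Smooth θ × NCTorus.Smooth θ),
      (∀ (ω : Connes.UForms (Connes.Doubled (NCTorus.Smooth θ)) 0) (a b : NCTorus.Smooth θ),
        Φ₀ (Submodule.Quotient.mk ω) = (a, b) →
        ∀ x y : NCTorus.Smooth θ,
          (NCTorus.doubledTriple θ).repForms 0 ω (x, y) = (a * x, b * y)) ∧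
      (∀ (ω : Connes.UForms (Connes.Doubled (NCTorus.Smooth θ)) 1) (a b c e : NCTorus.Smooth θ),
        Φ₁ (Submodule.Quotient.mk ω) = (a, b, c, e) →
        ∀ x y : NCTorus.Smooth θ,
          (NCTorus.doubledTriple θ).repForms 1 ω (x, y) =
            (a * y + b * NCTorus.dd θ y, c * x + e * NCTorus.ddStar θ x)) ∧
      (∀ (ω : Connes.UForms (Connes.Doubled (NCTorus.Smooth θ)) 2) (w w' : NCTorus.Smooth θ),
        Φ₂ (Submodule.Quotient.mk ω) = (w, w') →
        ∃ p q r p' q' r' : NCTorus.Smooth θ, ∀ x y : NCTorus.Smooth θ,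
          (NCTorus.doubledTriple θ).repForms 2 ω (x, y) =
            (p * x + q * NCTorus.dd θ x + r * NCTorus.ddStar θ x
                + w * NCTorus.dd θ (NCTorus.ddStar θ x),
              p' * y + q' * NCTorus.ddStar θ y + r' * NCTorus.dd θ y
                + w' * NCTorus.ddStar θ (NCTorus.dd θ y))) ∧
      (∀ (η : (NCTorus.doubledTriple θ).Forms 0) (a b : NCTorus.Smooth θ), Φ₀ η = (a, b) →
        Φ₁ ((NCTorus.doubledTriple θ).d 0 η) =
          (NCTorus.dd θ b, b - a, NCTorus.ddStar θ a, a - b)) ∧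
      (∀ (η : (NCTorus.doubledTriple θ).Forms 1) (a b c e : NCTorus.Smooth θ),
        Φ₁ η = (a, b, c, e) →
        Φ₂ ((NCTorus.doubledTriple θ).d 1 η) = (b + e, b + e))) ∧
    Nonempty ((NCTorus.doubledTriple θ).Cohomology 0 ≃ₗ[ℂ] ℂ) ∧
    Nonempty ((NCTorus.doubledTriple θ).Cohomology 1 ≃ₗ[ℂ]
      ℂ × ℂ × (NCTorus.Smooth θ ⧸ Connes.scalars (NCTorus.Smooth θ))) ∧
    Nontrivial ((NCTorus.doubledTriple θ).Cohomology 1) := by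
  let S := NCTorus.derivationPair θ
  obtain ⟨E⟩ := NCTorus.nonempty_cohomology_one θ
  exact ⟨⟨S.forms₀, S.forms₁, S.forms₂, S.repForms_zero_of_forms₀, S.repForms_one_of_forms₁,
    S.repForms_two_of_forms₂, S.forms₁_d, S.forms₂_d⟩,
    NCTorus.nonempty_cohomology_zero θ, ⟨E⟩, E.toEquiv.nontrivial⟩
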